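/- Let $d\ge 1$. For $n\ge1$ let $\mathbb T_n^d=\{\tfrac{2\pi}{2n+1}m:\ m\in\{-n,\dots,n\}^d\}$ be the discrete torus, a subset of $\mathbb T^d=(\mathbb R/2\pi\mathbb Z)^d$, with canonical vectors $e_j$ (of length $\tfrac{2\pi}{2n+1}$), $j=1,\dots,d$. Write $\varsigma_k(x)=e^{ik\cdot x}$ for $k\in\mathbb Z^d$, let $\langle\cdot,\cdot\rangle$ be the inner product of $L_2(\mathbb T^d)$ with respect to the normalized Lebesgue measure, and put $\langle g,h\rangle_n=(2n+1)^{-d}\sum_{x\in\mathbb T_n^d}g(x)\overline{h(x)}$. For $g:\mathbb T_n^d\to\mathbb R$ put $$\mathrm{ex}_n g=\sum_{k\in\{-n,\dots,n\}^d}\langle g,\varsigma_k\rangle_n\,\varsigma_k,\qquad \tau_jg(x)=g(x+e_j),$$ $$\nabla_ng(x)=\Big(\tfrac{2n+1}{2\pi}\big(g(x+e_j)-g(x)\big)\Big)_{j=1}^d,\qquad \|\nabla_n g\|_{n,\mathrm C}=\max_{x\in\mathbb T_n^d}|\nabla_ng(x)|.$$ For $J\ge0$ let $H_J$ be the space of real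 $f\in L_2(\mathbb T^d)$ with $\|f\|_{H_J}^2=\sum_{k\in\mathbb Z^d}(1+|k|^2)^J|\langle f,\varsigma_k\rangle|^2<\infty$. For each $n\ge1$ let $\rho_0^n:\mathbb T_n^d\to[0,1]$, and assume $\sup_{n\ge1}\|\nabla_n\rho_0^n\|_{n,\mathrm C}<\infty$. Let $(\eta_t^n)_{t\ge0}$ be the symmetric simple exclusion process on $\{0,1\}^{\mathbb T_n^d}$, i.e. the càdlàg Markov process with generator $$\mathcal G_nF(\eta)=\frac{(2n+1)^2}{2}\sum_{j=1}^d\sum_{x\in\mathbb T_n^d}\big[F(\eta^{x\leftrightarrow x+e_j})-F(\eta)\big],$$ where $\eta^{x\leftrightarrow y}$ is $\eta$ with the values at $x$ and $y$ exchanged, started from $\eta^n_0$ whose values $\eta_0^n(x)$, $x\in\mathbb T_n^d$, are independent Bernoulli variables with parameters $\rho_0^n(x)$. Let $\rho_t^n(x)=\mathbb E\,\eta_t^n(x)$ and $\zeta_t^n(x)=(2n+1)^{d/2}\big(\eta_t^n(x)-\rho_t^n(x)\big)$. Lemma. Let $J>\tfrac d2$ and $T>0$. There is a constant $C$, depending only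 on $d$, $J$, $T$ and $\sup_{n\ge1}\|\nabla_n\rho_0^n\|_{n,\mathrm C}$, such that for every $n\ge1$, every random variable $f$ with values in $H_J$ that is defined on the same probability space as $\zeta^n$ and satisfies $\mathbb E\|f\|_{H_J}^2<\infty$, every $j\in\{1,\dots,d\}$ and every $t\in[0,T]$, the random variable $\langle f,\mathrm{ex}_n[\zeta_t^n\,\tau_j\zeta_t^n]\rangle$ is integrable and $$\Big|\frac1{(2n+1)^{d}}\,\mathbb E\big\langle f,\mathrm{ex}_n[\zeta_t^n\,\tau_j\zeta_t^n]\big\rangle\Big|\le\frac{C}{n^{\frac d2\wedge1}}\;\mathbb E\big[\|f\|_{H_J}^2\big]^{1/2}.$$ -/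

import Mathlib

open MeasureTheory ProbabilityTheory Filter
open scoped NNReal ENNReal Topology ComplexConjugate

noncomputable section

namespace SSEP

/-! ### The continuous torus, its characters and its Sobolev spaces -/

instance factTwoPiPos : Fact (0 < 2 * Real.pi) := ⟨Real.two_pi_pos⟩

/-- The `d`-dimensional torus `(ℝ / 2πℤ)^d`. -/
abbrev Torus (d : ℕ) : Type := Fin d → AddCircle (2 * Real.pi)

/-- The normalized Lebesgue measure on the torus. -/
abbrev torusMeasure (d : ℕ) : Measure (Torus d) :=
  Measure.pi fun _ => (AddCircle.haarAddCircle : Measure (AddCircle (2 * Real.pi)))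

/-- The real Hilbert space `L₂(𝕋^d)`. -/
abbrev L2Torus (d : ℕ) : Type := Lp ℝ 2 (torusMeasure d)

/-- The character `ς_k(x) = exp(i k·x)`. -/
def character {d : ℕ} (k : Fin d → ℤ) (x : Torus d) : ℂ :=
  ∏ i, fourier (T := 2 * Real.pi) (k i) (x i)

/-- `ς_k(x) = exp(i k·x)` in terms of a real representative of the point. -/
theorem character_coe {d : ℕ} (k : Fin d → ℤ) (x : Fin d → ℝ) :
    character k (fun i => (x i : AddCircle (2 * Real.pi))) =
      Complex.exp (Complex.I * ∑ i, (k i : ℂ) * (x i : ℂ)) := by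
  unfold character
  rw [Finset.mul_sum, Complex.exp_sum]
  refine Finset.prod_congr rfl fun i _ => ?_
  rw [fourier_coe_apply]
  congr 1
  have : (Real.pi : ℂ) ≠ 0 := by exact_mod_cast Real.pi_ne_zero
  push_cast
  field_simp

theorem character_neg {d : ℕ} (k : Fin d → ℤ) (x : Torus d) :
    character (-k) x = conj (character k x) := by
  simp only [character, Pi.neg_apply, fourier_neg, map_prod]

theorem continuous_character {d : ℕ} (k : Fin d → ℤ) :
    Continuous (character k : Torus d → ℂ) := by
  unfold character
  fun_prop

theorem norm_character {d : ℕ} (k : Fin d → ℤ) (x : Torus d) : ‖character k x‖ = 1 := by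
  simp only [character, norm_prod, fourier_apply, Circle.norm_coe, Finset.prod_const_one]

/-- The Fourier coefficient `⟨f, ς_k⟩`. -/
def fourierCoef {d : ℕ} (f : L2Torus d) (k : Fin d → ℤ) : ℂ :=
  ∫ x, (f x : ℂ) * conj (character k x) ∂(torusMeasure d)

theorem integrable_mul_character {d : ℕ} (f : L2Torus d) (k : Fin d → ℤ) :
    Integrable (fun x => (f x : ℂ) * conj (character k x)) (torusMeasure d) := by
  have hf : Integrable (fun x => (f x : ℂ)) (torusMeasure d) :=
    ((Lp.memLp f).integrable (by norm_num)).ofReal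
  refine hf.mul_bdd (c := 1) ?_ ?_
  · exact (Complex.continuous_conj.comp (continuous_character k)).aestronglyMeasurable
  · exact Eventually.of_forall fun x => by simp [norm_character]

theorem fourierCoef_add {d : ℕ} (f g : L2Torus d) (k : Fin d → ℤ) :
    fourierCoef (f + g) k = fourierCoef f k + fourierCoef g k := by
  unfold fourierCoef
  rw [← integral_add (integrable_mul_character f k) (integrable_mul_character g k)]
  refine integral_congr_ae ?_
  filter_upwards [Lp.coeFn_add f g] with x hx
  rw [hx]
  simp only [Pi.add_apply]
  push_cast
  ring

theorem fourierCoef_smul {d : ℕ} (c : ℝ) (f : L2Torus d) (k : Fin d → ℤ) :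
    fourierCoef (c • f) k = c • fourierCoef f k := by
  unfold fourierCoef
  rw [← integral_smul]
  refine integral_congr_ae ?_
  filter_upwards [Lp.coeFn_smul c f] with x hx
  rw [hx]
  simp only [Pi.smul_apply, smul_eq_mul, Complex.real_smul]
  push_cast
  ring

/-- The weight `1 + |k|²`. -/
def weight {d : ℕ} (k : Fin d → ℤ) : ℝ := 1 + ∑ i, (k i : ℝ) ^ 2

theorem weight_pos {d : ℕ} (k : Fin d → ℤ) : 0 < weight k := by
  unfold weight
  positivity

/-- The sequence `(1 + |k|²)^{J/2} ⟨f, ς_k⟩`, as a linear function of `f`. -/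
def weightedCoef (d : ℕ) (J : ℝ) : L2Torus d →ₗ[ℝ] ((Fin d → ℤ) → ℂ) where
  toFun f k := (weight k ^ (J / 2) : ℝ) • fourierCoef f k
  map_add' f g := by
    funext k
    simp only [fourierCoef_add, smul_add, Pi.add_apply]
  map_smul' c f := by
    funext k
    simp only [fourierCoef_smul, Pi.smul_apply, RingHom.id_apply]
    rw [smul_comm]

theorem norm_sq_weightedCoef {d : ℕ} {J : ℝ} (f : L2Torus d) (k : Fin d → ℤ) :
    ‖weightedCoef d J f k‖ ^ 2 = weight k ^ J * ‖fourierCoef f k‖ ^ 2 := by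
  have h : ‖weightedCoef d J f k‖ = weight k ^ (J / 2) * ‖fourierCoef f k‖ := by
    simp only [weightedCoef, LinearMap.coe_mk, AddHom.coe_mk, norm_smul, Real.norm_eq_abs]
    rw [abs_of_nonneg (Real.rpow_nonneg (weight_pos k).le _)]
  rw [h, mul_pow, ← Real.rpow_natCast, ← Real.rpow_mul (weight_pos k).le]
  norm_num

theorem memlp_weightedCoef_iff {d : ℕ} {J : ℝ} (f : L2Torus d) :
    Memℓp (weightedCoef d J f) 2 ↔
      Summable fun k : Fin d → ℤ => weight k ^ J * ‖fourierCoef f k‖ ^ 2 := by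
  rw [memℓp_gen_iff (by norm_num)]
  simp only [ENNReal.toReal_ofNat, Real.rpow_ofNat, norm_sq_weightedCoef]

/-- For `J ≥ 0`: the functions in `L₂(𝕋^d)` with `∑_k (1 + |k|²)^J |⟨f, ς_k⟩|² < ∞`. -/
def sobolevSubmodule (d : ℕ) (J : ℝ) : Submodule ℝ (L2Torus d) where
  carrier := {f | Summable fun k : Fin d → ℤ => weight k ^ J * ‖fourierCoef f k‖ ^ 2}
  zero_mem' := by
    rw [Set.mem_ofPred_eq, ← memlp_weightedCoef_iff, map_zero]
    exact zero_memℓp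
  add_mem' := by
    intro f g hf hg
    rw [Set.mem_ofPred_eq, ← memlp_weightedCoef_iff] at hf hg ⊢
    rw [map_add]
    exact hf.add hg
  smul_mem' := by
    intro c f hf
    rw [Set.mem_ofPred_eq, ← memlp_weightedCoef_iff] at hf ⊢
    rw [map_smul]
    exact hf.const_smul c

/-- The Sobolev space `H_J`, `J ≥ 0`. It carries the norm of `H_J` defined below, not the one of
`L₂(𝕋^d)`. -/
structure Sobolev (d : ℕ) (J : ℝ) : Type where
  /-- the underlying element of `L₂(𝕋^d)` -/
  toL2 : L2Torus d
  mem : toL2 ∈ sobolevSubmodule d J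

namespace Sobolev

variable {d : ℕ} {J : ℝ}

/-- `H_J` as a set is the subspace `sobolevSubmodule d J` of `L₂(𝕋^d)`. -/
def equivSubmodule : Sobolev d J ≃ sobolevSubmodule d J where
  toFun f := ⟨f.toL2, f.mem⟩
  invFun f := ⟨f.1, f.2⟩

instance : AddCommGroup (Sobolev d J) := equivSubmodule.addCommGroup

instance : Module ℝ (Sobolev d J) := equivSubmodule.module ℝ

/-- The embedding `f ↦ ((1 + |k|²)^{J/2} ⟨f, ς_k⟩)_k` of `H_J` into `ℓ²`. -/
def toEllTwo : Sobolev d J →ₗ[ℝ] lp (fun _ : Fin d → ℤ => ℂ) 2 where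
  toFun f := ⟨weightedCoef d J f.toL2, (memlp_weightedCoef_iff f.toL2).2 f.mem⟩
  map_add' f g := by
    apply Subtype.ext
    exact (weightedCoef d J).map_add f.toL2 g.toL2
  map_smul' c f := by
    apply Subtype.ext
    exact (weightedCoef d J).map_smul c f.toL2

/-- The norm and the topology of `H_J`, see `norm_sq_eq` for the explicit formula. (The seminorm
instance suffices; that the norm vanishes only at `0` is the completeness of the characters.) -/
instance : SeminormedAddCommGroup (Sobolev d J) :=
  SeminormedAddCommGroup.induced _ _ (toEllTwo (d := d) (J := J))

instance : NormedSpace ℝ (Sobolev d J) := NormedSpace.induced ℝ _ _ (toEllTwo (d := d) (J := J))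

/-- `‖f‖_{H_J}² = ∑_k (1 + |k|²)^J |⟨f, ς_k⟩|²`. -/
theorem norm_sq_eq (f : Sobolev d J) :
    ‖f‖ ^ 2 = ∑' k : Fin d → ℤ, weight k ^ J * ‖fourierCoef f.toL2 k‖ ^ 2 := by
  have h := lp.norm_rpow_eq_tsum (p := 2) (by norm_num) (toEllTwo f)
  simp only [ENNReal.toReal_ofNat, Real.rpow_ofNat] at h
  refine Eq.trans h (tsum_congr fun k => ?_)
  exact norm_sq_weightedCoef f.toL2 k

end Sobolev

/-- The inner product `⟨f, h⟩` of `L₂(𝕋^d)` (normalized Lebesgue measure) of `f ∈ L₂(𝕋^d)` and a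
function `h`. -/
def pairing {d : ℕ} (f : L2Torus d) (h : Torus d → ℝ) : ℝ :=
  ∫ x, f x * h x ∂(torusMeasure d)

/-! ### The discrete torus -/

/-- The index set of the discrete torus: the class `m` stands for the point `2π m / (2n+1)`. -/
abbrev Site (d n : ℕ) : Type := Fin d → ZMod (2 * n + 1)

/-- The point `2π m / (2n+1)` of the torus that corresponds to the site `m`. -/
def Site.point {d n : ℕ} (m : Site d n) : Torus d :=
  fun i => ((2 * Real.pi * ((m i).val : ℝ) / (2 * n + 1) : ℝ) : AddCircle (2 * Real.pi))

/-- The canonical vector `e_j` of the discrete torus. -/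
def unitVec {d n : ℕ} (j : Fin d) : Site d n := Pi.single j 1

/-- The shift `τ_j f (x) = f (x + e_j)`. -/
def shift {d n : ℕ} (j : Fin d) (f : Site d n → ℝ) : Site d n → ℝ := fun x => f (x + unitVec j)

/-- The discrete gradient `∇_n f (x)`, with components
`(2n+1)/(2π) (f (x + e_j) - f x)`. -/
def discreteGrad {d n : ℕ} (f : Site d n → ℝ) (x : Site d n) : EuclideanSpace ℝ (Fin d) :=
  WithLp.toLp 2 fun j => (2 * (n : ℝ) + 1) / (2 * Real.pi) * (f (x + unitVec j) - f x)

/-- The maximum norm `max_x |∇_n f (x)|` of the discrete gradient. -/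
def discreteGradNorm {d n : ℕ} (f : Site d n → ℝ) : ℝ := ⨆ x, ‖discreteGrad f x‖

/-- The discrete Fourier coefficient `⟨f, ς_k⟩_n = (2n+1)^{-d} ∑_x f(x) conj(ς_k(x))`. -/
def discreteCoef {d n : ℕ} (f : Site d n → ℝ) (k : Fin d → ℤ) : ℂ :=
  ((2 * (n : ℂ) + 1) ^ d)⁻¹ * ∑ x : Site d n, (f x : ℂ) * conj (character k x.point)

/-- The set of frequencies `{-n, …, n}^d`. -/
def freqBox (d n : ℕ) : Finset (Fin d → ℤ) :=
  Fintype.piFinset fun _ => Finset.Icc (-(n : ℤ)) n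

/-- The extension operator `ex_n f (x) = ∑_{k ∈ {-n, …, n}^d} ⟨f, ς_k⟩_n ς_k(x)`; the sum is real,
see `ext_eq`. -/
def ext {d n : ℕ} (f : Site d n → ℝ) (x : Torus d) : ℝ :=
  (∑ k ∈ freqBox d n, discreteCoef f k * character k x).re

theorem ext_eq {d n : ℕ} (f : Site d n → ℝ) (x : Torus d) :
    (ext f x : ℂ) = ∑ k ∈ freqBox d n, discreteCoef f k * character k x := by
  unfold ext
  apply Complex.conj_eq_iff_re.1
  rw [map_sum]
  refine Finset.sum_nbij' (fun k => -k) (fun k => -k) ?_ ?_ ?_ ?_ ?_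
  · intro k hk
    simp only [freqBox, Fintype.mem_piFinset, Finset.mem_Icc, Pi.neg_apply] at hk ⊢
    intro i
    have := hk i
    omega
  · intro k hk
    simp only [freqBox, Fintype.mem_piFinset, Finset.mem_Icc, Pi.neg_apply] at hk ⊢
    intro i
    have := hk i
    omega
  · intro k _
    exact neg_neg k
  · intro k _
    exact neg_neg k
  · intro k _
    simp only [discreteCoef, map_mul, map_inv₀, map_pow, map_add, map_sum, map_one, map_natCast,
      map_ofNat, Complex.conj_ofReal, character_neg, Complex.conj_conj]

/-! ### The symmetric simple exclusion process -/

/-- Particle configurations `{0,1}^{𝕋_n^d}`; `true` means that the site is occupied. -/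
abbrev Config (d n : ℕ) : Type := Site d n → Bool

/-- The occupation number `η(x) ∈ {0, 1}`. -/
def occ {d n : ℕ} (η : Config d n) (x : Site d n) : ℝ := if η x then 1 else 0

/-- The configuration `η^{x ↔ y}` with the contents of `x` and `y` exchanged. -/
def exchange {d n : ℕ} (η : Config d n) (x y : Site d n) : Config d n :=
  fun z => η (Equiv.swap x y z)

/-- The generator
`G F (η) = (2n+1)²/2 ∑_j ∑_x (F (η^{x ↔ x + e_j}) - F η)`. -/
def generator (d n : ℕ) : (Config d n → ℝ) →ₗ[ℝ] (Config d n → ℝ) where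
  toFun F η := (2 * (n : ℝ) + 1) ^ 2 / 2 *
    ∑ j : Fin d, ∑ x : Site d n, (F (exchange η x (x + unitVec j)) - F η)
  map_add' F G := by
    funext η
    simp only [Pi.add_apply, ← mul_add, ← Finset.sum_add_distrib]
    congr 1
    refine Finset.sum_congr rfl fun j _ => Finset.sum_congr rfl fun x _ => ?_
    ring
  map_smul' c F := by
    funext η
    simp only [Pi.smul_apply, smul_eq_mul, RingHom.id_apply, Finset.mul_sum]
    refine Finset.sum_congr rfl fun j _ => Finset.sum_congr rfl fun x _ => ?_
    ring

/-- The Markov semigroup `exp (t G)` on functions of the configuration. -/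
def semigroup (d n : ℕ) (t : ℝ≥0) : (Config d n → ℝ) →L[ℝ] (Config d n → ℝ) :=
  NormedSpace.exp ((t : ℝ) • LinearMap.toContinuousLinearMap (generator d n))

/-- The σ-algebra generated by the process up to time `s`. -/
abbrev pastSigma {d n : ℕ} {Ω : Type*} (η : ℝ≥0 → Ω → Config d n) (s : ℝ≥0) : MeasurableSpace Ω :=
  ⨆ r : ℝ≥0, ⨆ _ : r ≤ s, MeasurableSpace.comap (η r) inferInstance

/-- `η` is a symmetric simple exclusion process: a process with values in `{0,1}^{𝕋_n^d}`, with
almost surely càdlàg paths (for a discrete state space: locally constant on the right and on the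
left of every time), which is Markov with respect to its own filtration, with the transition
semigroup generated by `generator d n`. -/
structure IsSSEP {d n : ℕ} {Ω : Type*} [MeasurableSpace Ω] (μ : Measure Ω)
    (η : ℝ≥0 → Ω → Config d n) : Prop where
  measurable : ∀ t, Measurable (η t)
  right_continuous : ∀ᵐ ω ∂μ, ∀ t, ∀ᶠ s in 𝓝[>] t, η s ω = η t ω
  left_limits : ∀ᵐ ω ∂μ, ∀ t, ∃ a, ∀ᶠ s in 𝓝[<] t, η s ω = a
  markov : ∀ (s t : ℝ≥0) (F : Config d n → ℝ),
    μ[fun ω => F (η (s + t) ω) | pastSigma η s] =ᵐ[μ] fun ω => semigroup d n t F (η s ω)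

/-- The random variables `η_0(x)` are independent and Bernoulli distributed with
parameters `ρ₀(x)`. -/
structure IsBernoulliStart {d n : ℕ} {Ω : Type*} [MeasurableSpace Ω] (μ : Measure Ω)
    (η : ℝ≥0 → Ω → Config d n) (ρ₀ : Site d n → ℝ) : Prop where
  indep : iIndepFun (fun x ω => η 0 ω x) μ
  prob_occupied : ∀ x, μ {ω | η 0 ω x = true} = ENNReal.ofReal (ρ₀ x)

/-- The expectation field `ρ_t(x) = 𝔼 η_t(x)`. -/
def meanField {d n : ℕ} {Ω : Type*} [MeasurableSpace Ω] (μ : Measure Ω)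
    (η : ℝ≥0 → Ω → Config d n) (t : ℝ≥0) (x : Site d n) : ℝ :=
  ∫ ω, occ (η t ω) x ∂μ

/-- The density fluctuation field `ζ_t(x) = (2n+1)^{d/2} (η_t(x) - ρ_t(x))`. -/
def fluctuation {d n : ℕ} {Ω : Type*} [MeasurableSpace Ω] (μ : Measure Ω)
    (η : ℝ≥0 → Ω → Config d n) (t : ℝ≥0) (ω : Ω) (x : Site d n) : ℝ :=
  (2 * (n : ℝ) + 1) ^ ((d : ℝ) / 2) * (occ (η t ω) x - meanField μ η t x)

end SSEP

end

noncomputable section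

namespace SSEP

/-! Since `f` may depend on the process, only its second moment is available. Cauchy–Schwarz over
the frequencies with weights `weight k ^ (±J / 2)`, and then over the probability space
(`abs_integral_pairing_le`), reduces the claim to second moments of the discrete Fourier
coefficients of products of neighbouring centered occupation numbers. As J > d/2, the weights
`weight k ^ (-J)` have bounded sum, so a bound of order n^{-(d ∧ 2)}, uniform in the frequency, is
enough. With N = (2n+1)^d, such a moment is N^{-2} times a double sum over sites x, y
(`integral_norm_sq_sum_le`): overlapping neighbour pairs contribute at most 3/N, all others are
four-point correlations.

The heart is therefore `exists_abs_correlation_four_le`. The centered correlation of a set A evolves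
by stirring A, plus a source for every pair of neighbours in A (`hasDerivAt_correlation`). The
source involves the gradient of the mean density and correlations of one or two sites fewer. The
gradient stays O(1/n), because the mean solves a discrete heat equation, and independence makes all
initial correlations vanish.

Hence a correlation is at most the source strength times the expected time that stirred particles
spend next to each other. That time is controlled by an explicit supersolution, `barrier`, built
from the Green function of the discrete Laplacian (`sum_barrier_stir_sub_le`); its size is ν =
n^{-1} for d = 1 and at most n^{-3/2} for d ≥ 2, up to constants. The maximum principle gives the
recursion `abs_correlation_le`, and hence the orders ν, nν², ν² + n²ν³ for two, three and four
sites. The last is O(n^{-(d ∧ 2)}). -/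

/-! ### A parabolic maximum principle on a finite state space -/

/-- A family of functions on a finite set that is nonpositive at time `0`, and whose time derivative
is nonpositive wherever the function is maximal in space, stays nonpositive. -/
theorem parabolic_maximum_principle {α : Type*} [Finite α] {T : ℝ} {W W' : ℝ → α → ℝ}
    (hd : ∀ a t, HasDerivAt (fun s => W s a) (W' t a) t)
    (h0 : ∀ a, W 0 a ≤ 0)
    (hmax : ∀ t a, 0 ≤ t → t ≤ T → (∀ b, W t b ≤ W t a) → W' t a ≤ 0) :
    ∀ t, 0 ≤ t → t ≤ T → ∀ a, W t a ≤ 0 := by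
  intro t₀ ht₀ hT a₀
  by_contra! hpos
  have hne : Nonempty α := ⟨a₀⟩
  -- Small enough that `W - ε * s` is still positive at `(t₀, a₀)`; the slope `-ε` makes the
  -- derivative strictly negative at a space-time maximum.
  set ε : ℝ := W t₀ a₀ / (2 * (t₀ + 1)) with hε
  have hεpos : 0 < ε := by positivity
  have hcont : ∀ a, ContinuousOn (fun s => W s a - ε * s) (Set.Icc 0 t₀) := fun a =>
    (Continuous.sub (continuous_iff_continuousAt.2 fun s => (hd a s).continuousAt)
      (by fun_prop)).continuousOn
  have hex : ∀ a, ∃ s ∈ Set.Icc 0 t₀, IsMaxOn (fun s => W s a - ε * s) (Set.Icc 0 t₀) s :=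
    fun a => isCompact_Icc.exists_isMaxOn ⟨0, by simp [ht₀]⟩ (hcont a)
  choose s hs hsmax using hex
  obtain ⟨a, ha⟩ := Finite.exists_max fun a => W (s a) a - ε * s a
  have hall : ∀ b, ∀ r ∈ Set.Icc 0 t₀, W r b - ε * r ≤ W (s a) a - ε * s a :=
    fun b r hr => (hsmax b hr).trans (ha b)
  have hval : 0 < W (s a) a - ε * s a := by
    refine lt_of_lt_of_le ?_ (hall a₀ t₀ ⟨ht₀, le_rfl⟩)
    have : ε * t₀ ≤ W t₀ a₀ / 2 := by
      rw [hε, div_mul_eq_mul_div, div_le_div_iff₀ (by positivity) (by norm_num)]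
      nlinarith
    linarith
  have hspos : 0 < s a := by
    rcases (hs a).1.lt_or_eq with h | h
    · exact h
    · rw [← h] at hval
      have := h0 a
      linarith
  have hW' : W' (s a) a ≤ 0 := by
    refine hmax _ _ hspos.le ((hs a).2.trans hT) fun b => ?_
    have := hall b _ (hs a)
    linarith
  have hderiv : HasDerivAt (fun r => W r a - ε * r) (W' (s a) a - ε) (s a) := by
    simpa [Pi.sub_def] using (hd a (s a)).fun_sub ((hasDerivAt_id (s a)).const_mul ε)
  have hlt : W' (s a) a - ε < 0 := by linarith
  -- Only times to the left are used, since the maximum may sit at the endpoint `t₀`. A negative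
  -- derivative gives larger values just before, a contradiction.
  have hev : ∀ᶠ r in 𝓝[<] (s a), W (s a) a - ε * s a < W r a - ε * r := by
    have := hderiv.hasDerivWithinAt (s := Set.Iio (s a))
    rw [hasDerivWithinAt_iff_tendsto_slope' (by simp)] at this
    filter_upwards [this.eventually (gt_mem_nhds hlt), self_mem_nhdsWithin] with r hr hrs
    rw [slope_def_field] at hr
    have hneg : r - s a < 0 := by simpa using hrs
    have := (div_neg_iff.1 hr).resolve_right (fun h => by linarith [h.2])
    linarith [this.1]
  have hev2 : ∀ᶠ r in 𝓝[<] (s a), 0 ≤ r :=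
    (eventually_gt_nhds hspos).filter_mono nhdsWithin_le_nhds |>.mono fun r hr => hr.le
  obtain ⟨r, ⟨hr1, hr2⟩, hr3⟩ := ((hev.and hev2).and self_mem_nhdsWithin).exists
  have hr3' : r < s a := hr3
  have := hall a r ⟨hr2, hr3'.le.trans (hs a).2⟩
  linarith

/-! ### The Green function of the discrete torus -/

variable {d n : ℕ}

/-- The real part of the character of the discrete torus with frequency `k`. -/
def wave (k z : Site d n) : ℝ := (ZMod.stdAddChar (∑ i, k i * z i)).re

/-- The eigenvalue of the negative discrete Laplacian `-(2n+1)² ∑_j (τ_j + τ_j⁻¹ - 2)` at the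
frequency `k`. -/
def eigenvalue (k : Site d n) : ℝ :=
  (2 * (n : ℝ) + 1) ^ 2 * ∑ j, (2 - 2 * (ZMod.stdAddChar (k j)).re)

/-- The mean-zero Green function of the discrete Laplacian; the frequency `0` does not contribute,
as `eigenvalue 0 = 0`. -/
def green (z : Site d n) : ℝ :=
  ((2 * (n : ℝ) + 1) ^ d)⁻¹ * ∑ k, wave k z / eigenvalue k

theorem norm_stdAddChar (x : ZMod (2 * n + 1)) : ‖ZMod.stdAddChar x‖ = 1 := by
  rw [ZMod.stdAddChar_apply, Circle.norm_coe]

theorem abs_wave_le (k z : Site d n) : |wave k z| ≤ 1 :=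
  (Complex.abs_re_le_norm _).trans (norm_stdAddChar _).le

theorem wave_zero (k : Site d n) : wave k 0 = 1 := by
  simp [wave]

theorem stdAddChar_neg (x : ZMod (2 * n + 1)) :
    ZMod.stdAddChar (-x) = conj (ZMod.stdAddChar x) :=
  AddChar.map_neg_eq_conj _ _

theorem wave_neg (k z : Site d n) : wave k (-z) = wave k z := by
  simp only [wave, Pi.neg_apply, mul_neg, Finset.sum_neg_distrib, stdAddChar_neg, Complex.conj_re]

theorem stdAddChar_sum {ι : Type*} (s : Finset ι) (f : ι → ZMod (2 * n + 1)) :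
    ZMod.stdAddChar (∑ i ∈ s, f i) = ∏ i ∈ s, ZMod.stdAddChar (f i) := by
  induction s using Finset.cons_induction with
  | empty => simp
  | cons a s ha ih => simp [AddChar.map_add_eq_mul, ih]

theorem sum_mul_add_unitVec (k z : Site d n) (j : Fin d) :
    ∑ i, k i * (z + unitVec j : Site d n) i = ∑ i, k i * z i + k j := by
  simp only [Pi.add_apply, mul_add, Finset.sum_add_distrib, unitVec]
  congr 1
  simp [Pi.single_apply]

theorem sum_mul_sub_unitVec (k z : Site d n) (j : Fin d) :
    ∑ i, k i * (z - unitVec j : Site d n) i = ∑ i, k i * z i + -k j := by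
  have := sum_mul_add_unitVec k (z - unitVec j) j
  rw [sub_add_cancel] at this
  rw [this]
  ring

theorem wave_add_add_wave_sub (k z : Site d n) (j : Fin d) :
    wave k (z + unitVec j) + wave k (z - unitVec j) =
      2 * (ZMod.stdAddChar (k j)).re * wave k z := by
  simp only [wave, sum_mul_add_unitVec, sum_mul_sub_unitVec, AddChar.map_add_eq_mul,
    stdAddChar_neg, Complex.mul_re, Complex.conj_re, Complex.conj_im]
  ring

/-- Orthogonality of characters, coordinate by coordinate. -/
theorem sum_wave (z : Site d n) :
    ∑ k, wave k z = if z = 0 then (2 * (n : ℝ) + 1) ^ d else 0 := by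
  have h : ∑ k : Site d n, ZMod.stdAddChar (∑ i, k i * z i) =
      ∏ i, ((if z i = 0 then Fintype.card (ZMod (2 * n + 1)) else 0 : ℕ) : ℂ) := by
    simp only [← AddChar.sum_mulShift _ (ZMod.isPrimitive_stdAddChar (2 * n + 1))]
    rw [Finset.prod_univ_sum, Fintype.piFinset_univ]
    refine Finset.sum_congr rfl fun k _ => ?_
    exact stdAddChar_sum _ _
  have hre : ∑ k, wave k z = (∑ k : Site d n, ZMod.stdAddChar (∑ i, k i * z i)).re := by
    rw [Complex.re_sum]
    rfl
  rw [hre, h]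
  split_ifs with hz
  · subst hz
    simp only [Pi.zero_apply, if_true, ZMod.card, Finset.prod_const, Finset.card_univ,
      Fintype.card_fin]
    norm_cast
  · obtain ⟨i, hi⟩ := Function.ne_iff.1 hz
    rw [Finset.prod_eq_zero (Finset.mem_univ i)]
    · rfl
    · rw [if_neg (by simpa using hi), Nat.cast_zero]

theorem re_stdAddChar (x : ZMod (2 * n + 1)) :
    (ZMod.stdAddChar x).re = Real.cos (2 * Real.pi * (x.valMinAbs : ℝ) / (2 * n + 1)) := by
  conv_lhs => rw [← ZMod.coe_valMinAbs x]
  rw [ZMod.stdAddChar_coe]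
  have : (2 * (Real.pi : ℂ) * Complex.I * (x.valMinAbs : ℂ) / ((2 * n + 1 : ℕ) : ℂ)) =
      ((2 * Real.pi * (x.valMinAbs : ℝ) / (2 * n + 1) : ℝ) : ℂ) * Complex.I := by
    push_cast
    ring
  rw [this, Complex.exp_ofReal_mul_I_re]

theorem abs_valMinAbs_le (x : ZMod (2 * n + 1)) : |x.valMinAbs| ≤ n := by
  have := ZMod.natAbs_valMinAbs_le x
  rw [Int.abs_eq_natAbs]
  omega

/-- The representative of least absolute value puts the angle in [-π, π], where cos θ ≤ 1 - 2θ²/π².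
Discrete eigenvalues thus dominate multiples of the continuous ones. -/
theorem sq_valMinAbs_le_sub_re (x : ZMod (2 * n + 1)) :
    16 * (x.valMinAbs : ℝ) ^ 2 ≤
      (2 * (n : ℝ) + 1) ^ 2 * (2 - 2 * (ZMod.stdAddChar x).re) := by
  rw [re_stdAddChar]
  have hx : |(x.valMinAbs : ℝ)| ≤ n := by exact_mod_cast abs_valMinAbs_le x
  have hM : (0 : ℝ) < 2 * n + 1 := by positivity
  have hpi := Real.pi_pos
  have h := Real.cos_le_one_sub_mul_cos_sq
    (x := 2 * Real.pi * (x.valMinAbs : ℝ) / (2 * n + 1)) (by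
    rw [abs_div, abs_mul, abs_of_pos hM, abs_of_pos (by positivity : 0 < 2 * Real.pi),
      div_le_iff₀ hM]
    nlinarith)
  have h2 : 2 / Real.pi ^ 2 * (2 * Real.pi * (x.valMinAbs : ℝ) / (2 * n + 1)) ^ 2 =
      8 * (x.valMinAbs : ℝ) ^ 2 / (2 * n + 1) ^ 2 := by
    field_simp
    ring
  rw [h2] at h
  have h3 : 16 * (x.valMinAbs : ℝ) ^ 2 =
      (2 * (n : ℝ) + 1) ^ 2 * (2 * (8 * (x.valMinAbs : ℝ) ^ 2 / (2 * n + 1) ^ 2)) := by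
    field_simp
    ring
  rw [h3]
  gcongr
  linarith

theorem sum_sq_valMinAbs_le_eigenvalue (k : Site d n) :
    16 * ∑ j, ((k j).valMinAbs : ℝ) ^ 2 ≤ eigenvalue k := by
  rw [eigenvalue, Finset.mul_sum, Finset.mul_sum]
  exact Finset.sum_le_sum fun j _ => sq_valMinAbs_le_sub_re (k j)

theorem weight_valMinAbs_le_eigenvalue {k : Site d n} (hk : k ≠ 0) :
    8 * weight (fun i => (k i).valMinAbs) ≤ eigenvalue k := by
  have h := sum_sq_valMinAbs_le_eigenvalue k
  have h1 : (1 : ℝ) ≤ ∑ j, ((k j).valMinAbs : ℝ) ^ 2 := by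
    obtain ⟨i, hi⟩ := Function.ne_iff.1 hk
    have hi' : (k i).valMinAbs ≠ 0 := by simpa using hi
    refine le_trans ?_ (Finset.single_le_sum (f := fun j => ((k j).valMinAbs : ℝ) ^ 2)
      (fun j _ => sq_nonneg _) (Finset.mem_univ i))
    have : 0 < (k i).valMinAbs ^ 2 := by positivity
    exact_mod_cast this
  rw [weight]
  linarith

theorem eigenvalue_pos {k : Site d n} (hk : k ≠ 0) : 0 < eigenvalue k :=
  lt_of_lt_of_le (by have := weight_pos fun i => (k i).valMinAbs; positivity)
    (weight_valMinAbs_le_eigenvalue hk)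

theorem eigenvalue_zero : eigenvalue (0 : Site d n) = 0 := by
  simp [eigenvalue]

theorem eigenvalue_nonneg (k : Site d n) : 0 ≤ eigenvalue k := by
  by_cases hk : k = 0
  · rw [hk, eigenvalue_zero]
  · exact (eigenvalue_pos hk).le

theorem green_neg (z : Site d n) : green (-z) = green z := by
  simp only [green, wave_neg]

/-- The Fourier coefficients of `green` are nonnegative, so its modulus is largest at the origin. -/
theorem abs_green_le (z : Site d n) : |green z| ≤ green (0 : Site d n) := by
  unfold green
  rw [abs_mul, abs_of_nonneg (by positivity)]
  gcongr
  refine (Finset.abs_sum_le_sum_abs _ _).trans (Finset.sum_le_sum fun k _ => ?_)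
  rw [abs_div, abs_of_nonneg (eigenvalue_nonneg k), wave_zero]
  exact div_le_div_of_nonneg_right (abs_wave_le k z) (eigenvalue_nonneg k)

/-- Each `wave k` is an eigenfunction, so Fourier inversion yields minus the delta function; the
missing zero frequency leaves the constant N^{-1}. -/
theorem laplacian_green (z : Site d n) :
    (2 * (n : ℝ) + 1) ^ 2 *
        ∑ j, (green (z + unitVec j) + green (z - unitVec j) - 2 * green z) =
      ((2 * (n : ℝ) + 1) ^ d)⁻¹ - if z = 0 then 1 else 0 := by
  have hM : (0 : ℝ) < 2 * n + 1 := by positivity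
  have h : (2 * (n : ℝ) + 1) ^ 2 *
        ∑ j, (green (z + unitVec j) + green (z - unitVec j) - 2 * green z) =
      ((2 * (n : ℝ) + 1) ^ d)⁻¹ * ∑ k, -(wave k z * (eigenvalue k / eigenvalue k)) := by
    simp only [green, Finset.mul_sum, ← Finset.sum_add_distrib, ← Finset.sum_sub_distrib]
    rw [Finset.sum_comm]
    refine Finset.sum_congr rfl fun k _ => ?_
    have : ∀ j, (2 * (n : ℝ) + 1) ^ 2 *
        (((2 * (n : ℝ) + 1) ^ d)⁻¹ * (wave k (z + unitVec j) / eigenvalue k) +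
          ((2 * (n : ℝ) + 1) ^ d)⁻¹ * (wave k (z - unitVec j) / eigenvalue k) -
          2 * (((2 * (n : ℝ) + 1) ^ d)⁻¹ * (wave k z / eigenvalue k))) =
        (2 * (n : ℝ) + 1) ^ 2 * (2 - 2 * (ZMod.stdAddChar (k j)).re) *
          (-((2 * (n : ℝ) + 1) ^ d)⁻¹ * (wave k z / eigenvalue k)) := by
      intro j
      have hw := wave_add_add_wave_sub k z j
      have hw' : wave k (z + unitVec j) =
        2 * (ZMod.stdAddChar (k j)).re * wave k z - wave k (z - unitVec j) := by linarith
      rw [hw']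
      ring
    simp only [this, ← Finset.sum_mul, ← Finset.mul_sum]
    rw [← eigenvalue]
    ring
  rw [h]
  -- At `k = 0` the quotient is 0 / 0 = 0, which is how the zero frequency drops out.
  have h2 : ∑ k, -(wave k z * (eigenvalue k / eigenvalue k)) = 1 - ∑ k, wave k z := by
    have : ∀ k : Site d n, -(wave k z * (eigenvalue k / eigenvalue k)) =
        (if k = 0 then 1 else 0) - wave k z := by
      intro k
      split_ifs with hk
      · subst hk
        simp [eigenvalue_zero, wave]
      · rw [div_self (eigenvalue_pos hk).ne']
        ring
    simp only [this, Finset.sum_sub_distrib]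
    simp
  rw [h2, sum_wave]
  split_ifs
  · field_simp
  · ring

theorem green_unitVec (j j' : Fin d) :
    green (unitVec j : Site d n) = green (unitVec j' : Site d n) := by
  unfold green
  congr 1
  have hw : ∀ (k : Site d n) (j : Fin d), wave k (unitVec j) = (ZMod.stdAddChar (k j)).re := by
    intro k j
    have := sum_mul_add_unitVec k 0 j
    simp only [zero_add, Pi.zero_apply, mul_zero, Finset.sum_const_zero] at this
    rw [wave, this]
  refine Fintype.sum_equiv (Equiv.arrowCongr (Equiv.swap j j') (Equiv.refl _)) _ _ fun k => ?_
  rw [hw, hw]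
  congr 1
  · simp [Equiv.arrowCongr]
  · simp only [eigenvalue]
    congr 1
    exact (Equiv.sum_comp (Equiv.swap j j')
      fun i => 2 - 2 * (ZMod.stdAddChar (k i)).re).symm

/-- By symmetry in the coordinates, `laplacian_green` at 0 reads 2d(2n+1)²(G(0) - G(e)) = 1 - 1/N,
and N ≥ 3. -/
theorem le_green_zero_sub_green_unitVec (hn : 1 ≤ n) (j : Fin d) :
    1 / (3 * d * (2 * (n : ℝ) + 1) ^ 2) ≤ green (0 : Site d n) - green (unitVec j : Site d n) := by
  have hd : (0 : ℝ) < d := by exact_mod_cast j.pos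
  have hn' : (1 : ℝ) ≤ n := by exact_mod_cast hn
  have h := laplacian_green (0 : Site d n)
  simp only [zero_add, zero_sub, green_neg, if_true, green_unitVec _ j, Finset.sum_const,
    Finset.card_univ, Fintype.card_fin, nsmul_eq_mul] at h
  have hN : ((2 * (n : ℝ) + 1) ^ d)⁻¹ ≤ 1 / 3 := by
    rw [one_div]
    apply inv_anti₀ (by norm_num)
    calc (3 : ℝ) ≤ (2 * (n : ℝ) + 1) ^ 1 := by linarith
      _ ≤ _ := pow_le_pow_right₀ (by linarith) j.pos
  rw [div_le_iff₀ (by positivity)]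
  linarith

end SSEP

namespace SSEP

/-! ### Sums of powers of the Sobolev weight -/

theorem summable_one_add_sq_rpow {s : ℝ} (hs : 1 / 2 < s) :
    Summable fun m : ℤ => (1 + (m : ℝ) ^ 2) ^ (-s) := by
  -- At m = 0 the left-hand term is 1, while the power of 0 with negative exponent is 0; the
  -- indicator supplies the difference.
  have h1 : Summable fun m : ℤ => |(m : ℝ)| ^ (-(2 * s)) + if m = 0 then (1 : ℝ) else 0 :=
    (Real.summable_abs_int_rpow (by linarith)).add
      (summable_of_hasFiniteSupport ((Set.finite_singleton (0 : ℤ)).subset fun m hm => by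
        by_contra h
        simp_all))
  refine Summable.of_nonneg_of_le (fun m => by positivity) (fun m => ?_) h1
  by_cases hm : m = 0
  · subst hm
    simp only [Int.cast_zero, abs_zero, if_true]
    have : (0 : ℝ) ≤ (0 : ℝ) ^ (-(2 * s)) := by positivity
    norm_num
    linarith
  · rw [if_neg hm, add_zero]
    have hm' : (0 : ℝ) < |(m : ℝ)| := abs_pos.2 (by exact_mod_cast hm)
    have : |(m : ℝ)| ^ (-(2 * s)) = ((m : ℝ) ^ 2) ^ (-s) := by
      rw [← sq_abs, ← Real.rpow_natCast, ← Real.rpow_mul hm'.le]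
      congr 1
      push_cast
      ring
    rw [this]
    exact Real.rpow_le_rpow_of_nonpos (by positivity) (by linarith) (by linarith)

theorem one_add_sq_le_weight {d : ℕ} (k : Fin d → ℤ) (i : Fin d) :
    1 + (k i : ℝ) ^ 2 ≤ weight k := by
  rw [weight]
  have := Finset.single_le_sum (f := fun i => (k i : ℝ) ^ 2)
      (fun j _ => sq_nonneg _) (Finset.mem_univ i)
  linarith

/-- Splitting the power evenly over the coordinates bounds the sum over frequencies by the d-th
power of a one-dimensional sum with exponent J/d > 1/2. -/
theorem weight_rpow_neg_le_prod {d : ℕ} (hd : 1 ≤ d) {J : ℝ} (hJ : 0 ≤ J) (k : Fin d → ℤ) :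
    weight k ^ (-J) ≤ ∏ i, (1 + (k i : ℝ) ^ 2) ^ (-(J / d)) := by
  have hd' : (d : ℝ) ≠ 0 := by exact_mod_cast (by omega : d ≠ 0)
  have h : weight k ^ (-J) = ∏ _i : Fin d, weight k ^ (-(J / d)) := by
    rw [Finset.prod_const, Finset.card_univ, Fintype.card_fin, ← Real.rpow_natCast,
      ← Real.rpow_mul (weight_pos k).le]
    congr 1
    field_simp
  rw [h]
  refine Finset.prod_le_prod (fun i _ => Real.rpow_nonneg (weight_pos k).le _) fun i _ => ?_
  exact Real.rpow_le_rpow_of_nonpos (by positivity) (one_add_sq_le_weight k i)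
    (neg_nonpos.2 (by positivity))

theorem exists_sum_weight_rpow_neg_le {d : ℕ} (hd : 1 ≤ d) {J : ℝ} (hJ : (d : ℝ) / 2 < J) :
    ∃ C : ℝ, 0 ≤ C ∧ ∀ n : ℕ, ∑ k ∈ freqBox d n, weight k ^ (-J) ≤ C := by
  have hd' : (0 : ℝ) < d := by exact_mod_cast hd
  have hs := summable_one_add_sq_rpow (s := J / d) (by
    rw [div_lt_div_iff₀ (by norm_num) hd']
    linarith)
  refine ⟨(∑' m : ℤ, (1 + (m : ℝ) ^ 2) ^ (-(J / d))) ^ d,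
    pow_nonneg (tsum_nonneg fun m => by positivity) _, fun n => ?_⟩
  have hJ0 : 0 ≤ J := by linarith [half_pos hd']
  calc ∑ k ∈ freqBox d n, weight k ^ (-J)
      ≤ ∑ k ∈ freqBox d n, ∏ i, (1 + (k i : ℝ) ^ 2) ^ (-(J / d)) :=
        Finset.sum_le_sum fun k _ => weight_rpow_neg_le_prod hd hJ0 k
    _ = ∏ _i : Fin d, ∑ m ∈ Finset.Icc (-(n : ℤ)) n, (1 + (m : ℝ) ^ 2) ^ (-(J / d)) := by
        rw [freqBox, Finset.prod_univ_sum]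
    _ = (∑ m ∈ Finset.Icc (-(n : ℤ)) n, (1 + (m : ℝ) ^ 2) ^ (-(J / d))) ^ d := by simp
    _ ≤ _ := by
        refine pow_le_pow_left₀ (Finset.sum_nonneg fun m _ => by positivity) ?_ _
        exact hs.sum_le_tsum _ fun m _ => by positivity

/-! ### The size of the Green function -/

theorem green_zero_le_sum_weight {d n : ℕ} :
    green (0 : Site d n) ≤
      ((2 * (n : ℝ) + 1) ^ d)⁻¹ * ∑ k ∈ freqBox d n, (weight k)⁻¹ := by
  unfold green
  gcongr
  have hinj : Function.Injective fun (k : Site d n) i => (k i).valMinAbs := fun k l h =>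
    funext fun i => ZMod.injective_valMinAbs (congrFun h i)
  calc ∑ k : Site d n, wave k 0 / eigenvalue k
      ≤ ∑ k : Site d n, (weight fun i => (k i).valMinAbs)⁻¹ := by
        refine Finset.sum_le_sum fun k _ => ?_
        have hw := weight_pos fun i => (k i).valMinAbs
        rw [wave_zero]
        by_cases hk : k = 0
        · rw [hk, eigenvalue_zero, div_zero]
          subst hk
          positivity
        · rw [one_div]
          exact inv_anti₀ hw (by linarith [weight_valMinAbs_le_eigenvalue hk])
    _ = ∑ k ∈ Finset.univ.map ⟨_, hinj⟩, (weight k)⁻¹ := by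
        rw [Finset.sum_map]
        rfl
    _ ≤ ∑ k ∈ freqBox d n, (weight k)⁻¹ := by
        refine Finset.sum_le_sum_of_subset_of_nonneg ?_
          fun k _ _ => inv_nonneg.2 (weight_pos k).le
        intro k hk
        simp only [Finset.mem_map, Finset.mem_univ, true_and, Function.Embedding.coeFn_mk] at hk
        obtain ⟨l, rfl⟩ := hk
        simp only [freqBox, Fintype.mem_piFinset, Finset.mem_Icc]
        exact fun i => abs_le.1 (abs_valMinAbs_le (l i))

/-- The rate of decay of the expected time that two particles spend at neighbouring sites. -/
def contactRate (d : ℕ) : ℝ := if d = 1 then 1 else 3 / 2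

theorem inv_pow_le_rpow {d n : ℕ} (hn : 1 ≤ n) :
    ((2 * (n : ℝ) + 1) ^ d)⁻¹ ≤ (n : ℝ) ^ (-(d : ℝ)) := by
  have hn' : (1 : ℝ) ≤ n := by exact_mod_cast hn
  rw [Real.rpow_neg (by positivity), Real.rpow_natCast]
  gcongr
  linarith

theorem contactRate_le {d : ℕ} (hd : 1 ≤ d) : contactRate d ≤ d := by
  unfold contactRate
  split_ifs with h
  · simp [h]
  · have : (2 : ℝ) ≤ d := by exact_mod_cast (by omega : 2 ≤ d)
    linarith

theorem inv_pow_le_contactRate {d n : ℕ} (hd : 1 ≤ d) (hn : 1 ≤ n) :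
    ((2 * (n : ℝ) + 1) ^ d)⁻¹ ≤ (n : ℝ) ^ (-contactRate d) :=
  (inv_pow_le_rpow hn).trans (Real.rpow_le_rpow_of_exponent_le (by exact_mod_cast hn)
    (neg_le_neg (contactRate_le hd)))

/-- For d = 1 the sum of inverse weights converges and the prefactor gives the rate. For d ≥ 2 it
need not stay bounded; a rate of 3/2, short of 2, avoids the logarithm in dimension two and still
suffices for the four-point bound. -/
theorem exists_green_zero_le {d : ℕ} (hd : 1 ≤ d) :
    ∃ C : ℝ, 0 ≤ C ∧ ∀ n : ℕ, 1 ≤ n →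
      green (0 : Site d n) ≤ C * (n : ℝ) ^ (-contactRate d) := by
  by_cases h1 : d = 1
  · subst h1
    obtain ⟨C, hC, h⟩ := exists_sum_weight_rpow_neg_le (d := 1) le_rfl (J := 1) (by norm_num)
    refine ⟨C, hC, fun n hn => green_zero_le_sum_weight.trans ?_⟩
    rw [mul_comm]
    simp only [Real.rpow_neg_one] at h
    exact mul_le_mul (h n) (inv_pow_le_contactRate le_rfl hn) (by positivity) hC
  · have hd2 : (2 : ℝ) ≤ d := by exact_mod_cast (by omega : 2 ≤ d)
    -- An exponent just above d/2, so `weight k ^ (-p)` is summable; the excess `weight k ^ (p - 1)`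
    -- is at most a constant times n^{2(p-1)} on the box, and -d + 2(p - 1) = -3/2.
    set p : ℝ := d / 2 + 1 / 4 with hp
    obtain ⟨C, hC, h⟩ := exists_sum_weight_rpow_neg_le hd (J := p) (by linarith)
    refine ⟨(1 + d) ^ (p - 1) * C, by positivity, fun n hn => green_zero_le_sum_weight.trans ?_⟩
    have hn' : (1 : ℝ) ≤ n := by exact_mod_cast hn
    have hsum : ∑ k ∈ freqBox d n, (weight k)⁻¹ ≤ ((1 + d) * (n : ℝ) ^ 2) ^ (p - 1) * C := by
      refine le_trans ?_ (mul_le_mul_of_nonneg_left (h n) (by positivity))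
      rw [Finset.mul_sum]
      refine Finset.sum_le_sum fun k hk => ?_
      have hw : weight k ≤ (1 + d) * (n : ℝ) ^ 2 := by
        have : ∑ i, (k i : ℝ) ^ 2 ≤ ∑ _i : Fin d, (n : ℝ) ^ 2 := by
          refine Finset.sum_le_sum fun i _ => sq_le_sq' ?_ ?_ <;>
          · have := Fintype.mem_piFinset.1 hk i
            rw [Finset.mem_Icc] at this
            first
              | exact_mod_cast this.1
              | exact_mod_cast this.2
        simp only [Finset.sum_const, Finset.card_univ, Fintype.card_fin, nsmul_eq_mul] at this
        rw [weight]
        nlinarith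
      calc (weight k)⁻¹ = weight k ^ (p - 1) * weight k ^ (-p) := by
            rw [← Real.rpow_add (weight_pos k), ← Real.rpow_neg_one]
            congr 1
            ring
        _ ≤ _ := mul_le_mul_of_nonneg_right
            (Real.rpow_le_rpow (weight_pos k).le hw (by linarith))
            (Real.rpow_nonneg (weight_pos k).le _)
    calc ((2 * (n : ℝ) + 1) ^ d)⁻¹ * ∑ k ∈ freqBox d n, (weight k)⁻¹
        ≤ (n : ℝ) ^ (-(d : ℝ)) * (((1 + d) * (n : ℝ) ^ 2) ^ (p - 1) * C) :=
          mul_le_mul (inv_pow_le_rpow hn) hsum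
            (Finset.sum_nonneg fun k _ => inv_nonneg.2 (weight_pos k).le) (by positivity)
      _ = (1 + d) ^ (p - 1) * C * ((n : ℝ) ^ (-(d : ℝ)) * (n : ℝ) ^ (2 * (p - 1))) := by
          rw [Real.mul_rpow (by positivity) (by positivity), ← Real.rpow_natCast,
            ← Real.rpow_mul (by positivity)]
          push_cast
          ring
      _ = _ := by
          rw [← Real.rpow_add (by positivity), contactRate, if_neg h1]
          congr 2
          rw [hp]
          ring

end SSEP

namespace SSEP

/-! ### The effect of an exchange on products of centered variables -/

/-- The subtracted sum is what the moving centering contributes to the time derivative. If at most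
one of `a`, `b` lies in `A`, it cancels the mismatch of the means exactly. If both do, with δ = ρ b
- ρ a, the product (X_b + δ)(X_a - δ) leaves -δ², and its linear terms double instead of cancelling.
-/
theorem prod_exchange_sub {α : Type*} [DecidableEq α] (u ρ : α → ℝ) {a b : α} (hab : a ≠ b)
    (A : Finset α) :
    ∏ c ∈ A, (u (Equiv.swap a b c) - ρ c) - ∏ c ∈ A, (u c - ρ c) -
        ∑ c ∈ A, (ρ (Equiv.swap a b c) - ρ c) * ∏ x ∈ A.erase c, (u x - ρ x) =
      (∏ c ∈ A.map (Equiv.swap a b).toEmbedding, (u c - ρ c) - ∏ c ∈ A, (u c - ρ c)) +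
        if a ∈ A ∧ b ∈ A then
          -(ρ b - ρ a) ^ 2 * ∏ c ∈ (A.erase a).erase b, (u c - ρ c) +
            2 * (ρ b - ρ a) *
              (∏ c ∈ A.erase b, (u c - ρ c) - ∏ c ∈ A.erase a, (u c - ρ c))
        else 0 := by
  have hB : ∀ B : Finset α, a ∉ B → b ∉ B → ∀ c ∈ B, Equiv.swap a b c = c := fun B ha hb c hc =>
    Equiv.swap_apply_of_ne_of_ne (fun h => ha (h ▸ hc)) (fun h => hb (h ▸ hc))
  have hP : ∀ B : Finset α, a ∉ B → b ∉ B →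
      ∏ c ∈ B, (u (Equiv.swap a b c) - ρ c) = ∏ c ∈ B, (u c - ρ c) := fun B ha hb =>
    Finset.prod_congr rfl fun c hc => by rw [hB B ha hb c hc]
  have hQ : ∀ B : Finset α, a ∉ B → b ∉ B →
      ∏ c ∈ B, (u (Equiv.swap a b c) - ρ (Equiv.swap a b c)) = ∏ c ∈ B, (u c - ρ c) :=
    fun B ha hb => Finset.prod_congr rfl fun c hc => by rw [hB B ha hb c hc]
  have hS : ∀ (B : Finset α) (g : α → ℝ), a ∉ B → b ∉ B →
      ∑ c ∈ B, (ρ (Equiv.swap a b c) - ρ c) * g c = 0 := fun B g ha hb =>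
    Finset.sum_eq_zero fun c hc => by rw [hB B ha hb c hc, sub_self, zero_mul]
  rw [Finset.prod_map]
  simp only [Equiv.coe_toEmbedding]
  by_cases ha : a ∈ A
  · by_cases hb : b ∈ A
    · obtain ⟨B, haB, hbB, rfl⟩ : ∃ B, a ∉ B ∧ b ∉ B ∧ A = insert a (insert b B) :=
        ⟨(A.erase a).erase b, by simp, by simp, by
          rw [Finset.insert_erase (Finset.mem_erase.2 ⟨hab.symm, hb⟩), Finset.insert_erase ha]⟩
      have haB' : a ∉ insert b B := by simp [hab, haB]
      have h1 : (insert a (insert b B)).erase a = insert b B := Finset.erase_insert haB'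
      have h2 : (insert a (insert b B)).erase b = insert a B := by
        rw [Finset.insert_comm, Finset.erase_insert (by simp [hab.symm, hbB])]
      have h3 : ((insert a (insert b B)).erase a).erase b = B := by
        rw [h1, Finset.erase_insert hbB]
      rw [if_pos ⟨ha, hb⟩, h3, Finset.sum_insert haB', Finset.sum_insert hbB, h1, h2,
        hS B _ haB hbB]
      simp only [Finset.prod_insert haB', Finset.prod_insert hbB, Finset.prod_insert haB,
        hP B haB hbB, hQ B haB hbB, Equiv.swap_apply_left, Equiv.swap_apply_right]
      ring
    · obtain ⟨B, haB, rfl⟩ : ∃ B, a ∉ B ∧ A = insert a B :=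
        ⟨A.erase a, by simp, (Finset.insert_erase ha).symm⟩
      have hbB : b ∉ B := fun h => hb (Finset.mem_insert_of_mem h)
      rw [if_neg (fun h => hb h.2), Finset.sum_insert haB, hS B _ haB hbB]
      simp only [Finset.prod_insert haB, Finset.erase_insert haB, hP B haB hbB, hQ B haB hbB,
        Equiv.swap_apply_left]
      ring
  · rw [if_neg (fun h => ha h.1)]
    by_cases hb : b ∈ A
    · obtain ⟨B, hbB, rfl⟩ : ∃ B, b ∉ B ∧ A = insert b B :=
        ⟨A.erase b, by simp, (Finset.insert_erase hb).symm⟩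
      have haB : a ∉ B := fun h => ha (Finset.mem_insert_of_mem h)
      rw [Finset.sum_insert hbB, hS B _ haB hbB]
      simp only [Finset.prod_insert hbB, Finset.erase_insert hbB, hP B haB hbB, hQ B haB hbB,
        Equiv.swap_apply_right]
      ring
    · rw [hS A _ ha hb, hP A ha hb, hQ A ha hb]
      ring

variable {d n : ℕ}

theorem unitVec_ne_zero (hn : 1 ≤ n) (j : Fin d) : (unitVec j : Site d n) ≠ 0 := by
  have : Fact (1 < 2 * n + 1) := ⟨by omega⟩
  intro h
  have := congrFun h j
  simp [unitVec] at this

theorem ne_add_unitVec (hn : 1 ≤ n) (j : Fin d) (y : Site d n) : y ≠ y + unitVec j := by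
  simpa using unitVec_ne_zero hn j

/-- Summed over the sites `y`, the exchanges of `y` and `y + e` act on a function of one site as a
second difference. -/
theorem sum_swap_sub (F : Site d n → ℝ) {e : Site d n} (he : e ≠ 0) (x : Site d n) :
    ∑ y, (F (Equiv.swap y (y + e) x) - F x) = F (x + e) + F (x - e) - 2 * F x := by
  have h : ∀ y, F (Equiv.swap y (y + e) x) - F x =
      (if y = x then F (x + e) - F x else 0) + if y = x - e then F (x - e) - F x else 0 := by
    intro y
    by_cases h1 : y = x
    · subst h1
      have : y ≠ y - e := fun h => he (by simpa using h.symm)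
      simp [this]
    · by_cases h2 : y = x - e
      · subst h2
        simp [he]
      · rw [if_neg h1, if_neg h2, Equiv.swap_apply_of_ne_of_ne (Ne.symm h1)
          (fun h => h2 (eq_sub_of_add_eq h.symm))]
        ring
  simp only [h, Finset.sum_add_distrib, Finset.sum_ite_eq', Finset.mem_univ, if_true]
  ring

/-- Compares two exclusion particles with two independent ones. They differ only when the exchange
swaps `a` and `b`: exclusion keeps `green` unchanged, while each independent jump would raise it to
`green 0`. The gain is kept for one orientation of the edge and discarded for the other. -/
theorem green_swap_sub_le {a b : Site d n} (hab : a ≠ b) {e : Site d n} (he : e ≠ 0)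
    (y : Site d n) :
    green (Equiv.swap y (y + e) a - Equiv.swap y (y + e) b) - green (a - b) ≤
      (green (Equiv.swap y (y + e) a - b) - green (a - b)) +
        (green (a - Equiv.swap y (y + e) b) - green (a - b)) -
        if y = a ∧ y + e = b then 2 * (green (0 : Site d n) - green e) else 0 := by
  have hye : y ≠ y + e := by simpa using he
  by_cases hya : y = a
  · subst hya
    by_cases hyb : y + e = b
    · subst hyb
      have h1 : y - (y + e) = -e := by abel
      have h2 : y + e - y = e := by abel
      simp only [Equiv.swap_apply_left, Equiv.swap_apply_right, h1, h2, green_neg, sub_self,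
        and_self, if_true]
      linarith
    · rw [if_neg (fun h => hyb h.2), Equiv.swap_apply_of_ne_of_ne hab.symm (Ne.symm hyb)]
      linarith
  · rw [if_neg (fun h => hya h.1)]
    by_cases hya' : y + e = a
    · subst hya'
      by_cases hyb : y = b
      · subst hyb
        have h1 : y - (y + e) = -e := by abel
        have h2 : y + e - y = e := by abel
        simp only [Equiv.swap_apply_left, Equiv.swap_apply_right, h1, h2, green_neg, sub_self]
        linarith [(abs_le.1 (abs_green_le e)).2]
      · rw [Equiv.swap_apply_of_ne_of_ne (Ne.symm hyb) hab.symm]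
        linarith
    · rw [Equiv.swap_apply_of_ne_of_ne (Ne.symm hya) (Ne.symm hya')]
      linarith

/-- Each independent particle contributes the Laplacian of `green` at `a - b ≠ 0`, hence N^{-1} in
total; the gain at contact is bounded below by `le_green_zero_sub_green_unitVec`. -/
theorem sum_green_swap_sub_le (hn : 1 ≤ n) {a b : Site d n} (hab : a ≠ b) :
    (2 * (n : ℝ) + 1) ^ 2 / 2 * ∑ j : Fin d, ∑ y : Site d n,
        (green (Equiv.swap y (y + unitVec j) a - Equiv.swap y (y + unitVec j) b) -
          green (a - b)) ≤
      ((2 * (n : ℝ) + 1) ^ d)⁻¹ - 1 / (3 * d) * ∑ j : Fin d, ∑ y : Site d n,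
        if y = a ∧ y + unitVec j = b then 1 else 0 := by
  have hstep : ∀ j : Fin d, ∑ y : Site d n,
        (green (Equiv.swap y (y + unitVec j) a - Equiv.swap y (y + unitVec j) b) -
          green (a - b)) ≤
      2 * (green (a - b + unitVec j) + green (a - b - unitVec j) - 2 * green (a - b)) -
        2 / (3 * d * (2 * (n : ℝ) + 1) ^ 2) *
          ∑ y : Site d n, if y = a ∧ y + unitVec j = b then 1 else 0 := by
    intro j
    have he := unitVec_ne_zero hn j
    refine (Finset.sum_le_sum fun y _ => green_swap_sub_le hab he y).trans ?_
    rw [Finset.sum_sub_distrib, Finset.sum_add_distrib,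
      sum_swap_sub (fun x => green (x - b)) he a, sum_swap_sub (fun x => green (a - x)) he b,
      Finset.mul_sum]
    have h1 : a + unitVec j - b = a - b + unitVec j := by abel
    have h2 : a - unitVec j - b = a - b - unitVec j := by abel
    have h3 : a - (b + unitVec j) = a - b - unitVec j := by abel
    have h4 : a - (b - unitVec j) = a - b + unitVec j := by abel
    rw [h1, h2, h3, h4]
    have h5 : ∑ y : Site d n, 2 / (3 * d * (2 * (n : ℝ) + 1) ^ 2) *
          (if y = a ∧ y + unitVec j = b then (1 : ℝ) else 0) ≤
        ∑ y : Site d n, if y = a ∧ y + unitVec j = b then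
          2 * (green (0 : Site d n) - green (unitVec j : Site d n)) else 0 := by
      refine Finset.sum_le_sum fun y _ => ?_
      split_ifs
      · have := le_green_zero_sub_green_unitVec hn j
        rw [mul_one]
        calc 2 / (3 * d * (2 * (n : ℝ) + 1) ^ 2) = 2 * (1 / (3 * d * (2 * (n : ℝ) + 1) ^ 2)) := by
              ring
          _ ≤ _ := by linarith
      · simp
    linarith
  have hlap := laplacian_green (a - b)
  rw [if_neg (sub_ne_zero.2 hab), sub_zero] at hlap
  calc _ ≤ (2 * (n : ℝ) + 1) ^ 2 / 2 * ∑ j : Fin d,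
      (2 * (green (a - b + unitVec j) + green (a - b - unitVec j) - 2 * green (a - b)) -
        2 / (3 * d * (2 * (n : ℝ) + 1) ^ 2) *
          ∑ y : Site d n, if y = a ∧ y + unitVec j = b then 1 else 0) := by
        gcongr with j
        exact hstep j
    _ = _ := by
        rw [Finset.sum_sub_distrib, ← Finset.mul_sum, ← Finset.mul_sum, ← hlap]
        field_simp

/-! ### Evolution of the correlation functions -/

/-- A family of linear functionals that solves the forward equation of the exclusion process. -/
structure IsForwardEvolution (φ : ℝ → (Config d n → ℝ) →L[ℝ] ℝ) : Prop where
  hasDerivAt : ∀ t, HasDerivAt φ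
    ((φ t).comp (LinearMap.toContinuousLinearMap (generator d n))) t
  map_one : ∀ t, 0 ≤ t → φ t (fun _ => 1) = 1

/-- The mean occupation of a site. -/
def mean (φ : ℝ → (Config d n → ℝ) →L[ℝ] ℝ) (t : ℝ) (x : Site d n) : ℝ :=
  φ t fun η => occ η x

/-- The centered correlation function of the occupation numbers of a set of sites. -/
def correlation (φ : ℝ → (Config d n → ℝ) →L[ℝ] ℝ) (t : ℝ) (A : Finset (Site d n)) : ℝ :=
  φ t fun η => ∏ a ∈ A, (occ η a - mean φ t a)

/-- The permutation of the sites that exchanges `y` and `y + e_j`. -/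
abbrev stir (j : Fin d) (y : Site d n) : Equiv.Perm (Site d n) := Equiv.swap y (y + unitVec j)

theorem occ_exchange (η : Config d n) (x y z : Site d n) :
    occ (exchange η x y) z = occ η (Equiv.swap x y z) := rfl

variable {φ : ℝ → (Config d n → ℝ) →L[ℝ] ℝ}

theorem generator_apply (F : Config d n → ℝ) :
    generator d n F = ((2 * (n : ℝ) + 1) ^ 2 / 2) • ∑ j : Fin d, ∑ y : Site d n,
      fun η => F (exchange η y (y + unitVec j)) - F η := by
  funext η
  simp [generator]

theorem IsForwardEvolution.hasDerivAt_mean (hφ : IsForwardEvolution φ) (x : Site d n) (t : ℝ) :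
    HasDerivAt (fun s => mean φ s x)
      ((2 * (n : ℝ) + 1) ^ 2 / 2 * ∑ j : Fin d, ∑ y : Site d n,
        (mean φ t (stir j y x) - mean φ t x)) t := by
  have h := (hφ.hasDerivAt t).clm_apply (hasDerivAt_const t fun η : Config d n => occ η x)
  simp only [map_zero, add_zero] at h
  refine HasDerivAt.congr_deriv h ?_
  rw [ContinuousLinearMap.comp_apply, LinearMap.coe_toContinuousLinearMap', generator_apply]
  simp only [map_smul, map_sum, smul_eq_mul]
  congr 1
  refine Finset.sum_congr rfl fun j _ => Finset.sum_congr rfl fun y _ => ?_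
  rw [mean, mean, ← map_sub]
  rfl

/-- The product rule gives the generator term and the drift of the means; `prod_exchange_sub`
combines them edge by edge. The hierarchy involves no larger sets. -/
theorem IsForwardEvolution.hasDerivAt_correlation (hφ : IsForwardEvolution φ) (hn : 1 ≤ n)
    (A : Finset (Site d n)) (t : ℝ) :
    HasDerivAt (fun s => correlation φ s A)
      ((2 * (n : ℝ) + 1) ^ 2 / 2 * ∑ j : Fin d, ∑ y : Site d n,
        ((correlation φ t (A.map (stir j y).toEmbedding) - correlation φ t A) +
          if y ∈ A ∧ y + unitVec j ∈ A then
            -(mean φ t (y + unitVec j) - mean φ t y) ^ 2 *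
                correlation φ t ((A.erase y).erase (y + unitVec j)) +
              2 * (mean φ t (y + unitVec j) - mean φ t y) *
                (correlation φ t (A.erase (y + unitVec j)) - correlation φ t (A.erase y))
          else 0)) t := by
  have hF : HasDerivAt (fun s => fun η : Config d n => ∏ a ∈ A, (occ η a - mean φ s a))
      (fun η => ∑ c ∈ A, (∏ a ∈ A.erase c, (occ η a - mean φ t a)) *
        -((2 * (n : ℝ) + 1) ^ 2 / 2 * ∑ j : Fin d, ∑ y : Site d n,
          (mean φ t (stir j y c) - mean φ t c))) t := by
    rw [hasDerivAt_pi]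
    intro η
    have := HasDerivAt.fun_finsetProd (u := A) (x := t)
      (f := fun a s => occ η a - mean φ s a)
      (f' := fun c => -((2 * (n : ℝ) + 1) ^ 2 / 2 * ∑ j : Fin d, ∑ y : Site d n,
          (mean φ t (stir j y c) - mean φ t c)))
      (fun c _ => (hφ.hasDerivAt_mean c t).const_sub _)
    simpa only [smul_eq_mul] using this
  have h := (hφ.hasDerivAt t).clm_apply hF
  refine HasDerivAt.congr_deriv h ?_
  rw [ContinuousLinearMap.comp_apply, LinearMap.coe_toContinuousLinearMap', ← map_add]
  have key : (generator d n fun η => ∏ a ∈ A, (occ η a - mean φ t a)) +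
      (fun η => ∑ c ∈ A, (∏ a ∈ A.erase c, (occ η a - mean φ t a)) *
        -((2 * (n : ℝ) + 1) ^ 2 / 2 * ∑ j : Fin d, ∑ y : Site d n,
          (mean φ t (stir j y c) - mean φ t c))) =
      ((2 * (n : ℝ) + 1) ^ 2 / 2) • ∑ j : Fin d, ∑ y : Site d n,
        (((fun η => ∏ a ∈ A.map (stir j y).toEmbedding, (occ η a - mean φ t a)) -
            fun η => ∏ a ∈ A, (occ η a - mean φ t a)) +
          if y ∈ A ∧ y + unitVec j ∈ A then
            (-(mean φ t (y + unitVec j) - mean φ t y) ^ 2) •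
                (fun η => ∏ a ∈ (A.erase y).erase (y + unitVec j), (occ η a - mean φ t a)) +
              (2 * (mean φ t (y + unitVec j) - mean φ t y)) •
                ((fun η => ∏ a ∈ A.erase (y + unitVec j), (occ η a - mean φ t a)) -
                  fun η => ∏ a ∈ A.erase y, (occ η a - mean φ t a))
          else 0) := by
    funext η
    rw [generator_apply]
    have hedge : ∀ (j : Fin d) (y : Site d n), _ := fun j y =>
      prod_exchange_sub (occ η) (mean φ t) (ne_add_unitVec hn j y) A
    have hsum : ∑ c ∈ A, (∏ a ∈ A.erase c, (occ η a - mean φ t a)) *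
        -((2 * (n : ℝ) + 1) ^ 2 / 2 * ∑ j : Fin d, ∑ y : Site d n,
          (mean φ t (stir j y c) - mean φ t c)) =
        (2 * (n : ℝ) + 1) ^ 2 / 2 * ∑ j : Fin d, ∑ y : Site d n,
          -∑ c ∈ A, (mean φ t (stir j y c) - mean φ t c) *
            ∏ a ∈ A.erase c, (occ η a - mean φ t a) := by
      simp only [Finset.mul_sum, ← Finset.sum_neg_distrib]
      rw [Finset.sum_comm]
      refine Finset.sum_congr rfl fun j _ => ?_
      rw [Finset.sum_comm]
      refine Finset.sum_congr rfl fun y _ => Finset.sum_congr rfl fun c _ => ?_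
      ring
    simp only [Pi.add_apply, Pi.smul_apply, Finset.sum_apply, smul_eq_mul, hsum, ← mul_add,
      ← Finset.sum_add_distrib, occ_exchange]
    congr 1
    refine Finset.sum_congr rfl fun j _ => Finset.sum_congr rfl fun y _ => ?_
    rw [← sub_eq_add_neg]
    refine (hedge j y).trans ?_
    split_ifs <;> rfl
  rw [key]
  simp only [map_smul, map_sum, map_add, map_sub, smul_eq_mul]
  congr 1
  refine Finset.sum_congr rfl fun j _ => Finset.sum_congr rfl fun y _ => ?_
  congr 1
  split_ifs
  · simp only [map_smul, map_add, map_sub, smul_eq_mul]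
    rfl
  · rw [map_zero]

theorem IsForwardEvolution.correlation_empty (hφ : IsForwardEvolution φ) {t : ℝ} (ht : 0 ≤ t) :
    correlation φ t ∅ = 1 := by
  simp only [correlation, Finset.prod_empty]
  exact hφ.map_one t ht

theorem IsForwardEvolution.correlation_singleton (hφ : IsForwardEvolution φ) {t : ℝ} (ht : 0 ≤ t)
    (x : Site d n) : correlation φ t {x} = 0 := by
  simp only [correlation, Finset.prod_singleton]
  have : (fun η : Config d n => occ η x - mean φ t x) =
      (fun η => occ η x) - mean φ t x • fun _ => 1 := by
    funext η
    simp
  rw [this, map_sub, map_smul, hφ.map_one t ht, smul_eq_mul, mul_one, mean, sub_self]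

end SSEP

/-! ### Gradient bound, barrier and recursive estimate -/

namespace SSEP

variable {d n : ℕ} {φ : ℝ → (Config d n → ℝ) →L[ℝ] ℝ}

/-- The discrete gradient of the mean occupation does not grow in time. -/
theorem IsForwardEvolution.abs_mean_add_sub_le (hφ : IsForwardEvolution φ) (hn : 1 ≤ n)
    {D : ℝ} (j : Fin d) (h0 : ∀ x, |mean φ 0 (x + unitVec j) - mean φ 0 x| ≤ D)
    {t : ℝ} (ht : 0 ≤ t) (x : Site d n) :
    |mean φ t (x + unitVec j) - mean φ t x| ≤ D := by
  have key : ∀ s : ℝ, |s| = 1 →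
      s * (mean φ t (x + unitVec j) - mean φ t x) - D ≤ 0 := by
    intro s hs
    refine parabolic_maximum_principle (T := t)
      (W := fun t x => s * (mean φ t (x + unitVec j) - mean φ t x) - D)
      (fun a t => (((hφ.hasDerivAt_mean (a + unitVec j) t).fun_sub
        (hφ.hasDerivAt_mean a t)).const_mul s).sub_const D) (fun a => ?_) ?_ t ht le_rfl x
    · have := (le_abs_self (s * (mean φ 0 (a + unitVec j) - mean φ 0 a)))
      rw [abs_mul, hs, one_mul] at this
      linarith [h0 a]
    -- The exchange sums are discrete Laplacians, which commute with shifts; so the difference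
    -- solves the heat equation, and its Laplacian is nonpositive at a spatial maximum.
    · intro r a _ _ hmax
      have hrw : ∀ z : Site d n, ∑ j' : Fin d, ∑ y : Site d n,
          (mean φ r (stir j' y z) - mean φ r z) = ∑ j' : Fin d,
          (mean φ r (z + unitVec j') + mean φ r (z - unitVec j') - 2 * mean φ r z) := fun z =>
        Finset.sum_congr rfl fun j' _ => sum_swap_sub _ (unitVec_ne_zero hn j') z
      simp only [hrw]
      rw [← mul_sub, ← Finset.sum_sub_distrib, mul_left_comm, Finset.mul_sum]
      refine mul_nonpos_of_nonneg_of_nonpos (by positivity) (Finset.sum_nonpos fun j' _ => ?_)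
      have h1 := hmax (a + unitVec j')
      have h2 := hmax (a - unitVec j')
      rw [add_right_comm] at h1
      rw [sub_add_eq_add_sub] at h2
      nlinarith
  rw [abs_le]
  constructor
  · have := key (-1) (by simp)
    linarith
  · have := key 1 (by simp)
    linarith

/-- The barrier that dominates the correlation functions of sets of sites. -/
def barrier (t : ℝ) (A : Finset (Site d n)) : ℝ :=
  ∑ a ∈ A, ∑ b ∈ A, if a = b then 0 else
    (green (0 : Site d n) + green (a - b) + t * ((2 * (n : ℝ) + 1) ^ d)⁻¹)

theorem green_zero_nonneg : 0 ≤ green (0 : Site d n) := (abs_nonneg _).trans (abs_green_le 0)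

/-- This is what the summand `green 0` in `barrier` is for: `green` itself changes sign. -/
theorem barrier_nonneg {t : ℝ} (ht : 0 ≤ t) (A : Finset (Site d n)) : 0 ≤ barrier t A := by
  refine Finset.sum_nonneg fun a _ => Finset.sum_nonneg fun b _ => ?_
  split_ifs
  · exact le_rfl
  · have := (abs_le.1 (abs_green_le (a - b))).1
    have : 0 ≤ t * ((2 * (n : ℝ) + 1) ^ d)⁻¹ := by positivity
    linarith

theorem barrier_le {t : ℝ} (ht : 0 ≤ t) (A : Finset (Site d n)) :
    barrier t A ≤ (A.card : ℝ) ^ 2 *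
      (2 * green (0 : Site d n) + t * ((2 * (n : ℝ) + 1) ^ d)⁻¹) := by
  have h : barrier t A ≤ ∑ _a ∈ A, ∑ _b ∈ A,
      (2 * green (0 : Site d n) + t * ((2 * (n : ℝ) + 1) ^ d)⁻¹) := by
    refine Finset.sum_le_sum fun a _ => Finset.sum_le_sum fun b _ => ?_
    have h0 : 0 ≤ t * ((2 * (n : ℝ) + 1) ^ d)⁻¹ := by positivity
    split_ifs
    · have := green_zero_nonneg (d := d) (n := n)
      linarith
    · have := (abs_le.1 (abs_green_le (a - b))).2
      linarith
  refine h.trans (le_of_eq ?_)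
  simp only [Finset.sum_const, nsmul_eq_mul]
  ring

/-- The derivative of the term linear in time pays for the constant N^{-1} in
`sum_green_swap_sub_le`. -/
theorem hasDerivAt_barrier (t : ℝ) (A : Finset (Site d n)) :
    HasDerivAt (fun s => barrier s A)
      (∑ a ∈ A, ∑ b ∈ A, if a = b then 0 else ((2 * (n : ℝ) + 1) ^ d)⁻¹) t := by
  unfold barrier
  refine HasDerivAt.fun_sum fun a _ => HasDerivAt.fun_sum fun b _ => ?_
  split_ifs
  · exact hasDerivAt_const _ _
  · simpa using ((hasDerivAt_id t).mul_const ((2 * (n : ℝ) + 1) ^ d)⁻¹).const_add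
      (green (0 : Site d n) + green (a - b))

/-- The barrier is a supersolution of the stirring dynamics with a source at the pairs of
neighbouring sites. -/
theorem sum_barrier_stir_sub_le (hd : 1 ≤ d) (hn : 1 ≤ n) (t : ℝ) (A : Finset (Site d n)) :
    3 * d * ((2 * (n : ℝ) + 1) ^ 2 / 2 * ∑ j : Fin d, ∑ y : Site d n,
        (barrier t (A.map (stir j y).toEmbedding) - barrier t A)) +
      ∑ j : Fin d, ∑ y : Site d n, (if y ∈ A ∧ y + unitVec j ∈ A then 1 else 0) ≤
    3 * d * ∑ a ∈ A, ∑ b ∈ A, if a = b then 0 else ((2 * (n : ℝ) + 1) ^ d)⁻¹ := by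
  have hd' : (0 : ℝ) < d := by exact_mod_cast hd
  have h1 : ∀ (j : Fin d) (y : Site d n),
      barrier t (A.map (stir j y).toEmbedding) - barrier t A =
        ∑ a ∈ A, ∑ b ∈ A, if a = b then 0 else
          (green (stir j y a - stir j y b) - green (a - b)) := by
    intro j y
    simp only [barrier, Finset.sum_map, Equiv.coe_toEmbedding, (stir j y).injective.eq_iff,
      ← Finset.sum_sub_distrib]
    refine Finset.sum_congr rfl fun a _ => Finset.sum_congr rfl fun b _ => ?_
    split_ifs <;> ring
  have h2 : (2 * (n : ℝ) + 1) ^ 2 / 2 * ∑ j : Fin d, ∑ y : Site d n,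
        (barrier t (A.map (stir j y).toEmbedding) - barrier t A) =
      ∑ a ∈ A, ∑ b ∈ A, if a = b then 0 else
        (2 * (n : ℝ) + 1) ^ 2 / 2 * ∑ j : Fin d, ∑ y : Site d n,
          (green (stir j y a - stir j y b) - green (a - b)) := by
    simp only [h1]
    have hy : ∀ j : Fin d, (∑ y : Site d n, ∑ a ∈ A, ∑ b ∈ A, if a = b then 0 else
          (green (stir j y a - stir j y b) - green (a - b))) =
        ∑ a ∈ A, ∑ b ∈ A, if a = b then 0 else ∑ y : Site d n,
          (green (stir j y a - stir j y b) - green (a - b)) := by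
      intro j
      rw [Finset.sum_comm]
      refine Finset.sum_congr rfl fun a _ => ?_
      rw [Finset.sum_comm]
      refine Finset.sum_congr rfl fun b _ => ?_
      split_ifs <;> simp
    simp only [hy]
    rw [Finset.sum_comm, Finset.mul_sum]
    refine Finset.sum_congr rfl fun a _ => ?_
    rw [Finset.sum_comm, Finset.mul_sum]
    refine Finset.sum_congr rfl fun b _ => ?_
    split_ifs <;> simp
  have h3 : ∀ (j : Fin d) (y : Site d n),
      (if y ∈ A ∧ y + unitVec j ∈ A then (1 : ℝ) else 0) =
        ∑ a ∈ A, ∑ b ∈ A, if a = b then 0 else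
          if y = a ∧ y + unitVec j = b then 1 else 0 := by
    intro j y
    have hne := ne_add_unitVec hn j y
    have : ∀ a b : Site d n, (if a = b then (0 : ℝ) else
        if y = a ∧ y + unitVec j = b then 1 else 0) =
        if y = a then (if y + unitVec j = b then 1 else 0) else 0 := by
      intro a b
      by_cases ha : y = a
      · subst ha
        by_cases hb : y + unitVec j = b
        · subst hb
          simp [unitVec_ne_zero hn j]
        · simp [hb]
      · simp [ha]
    simp only [this]
    have h4 : ∀ a, (∑ b ∈ A, if y = a then (if y + unitVec j = b then (1 : ℝ) else 0) else 0) =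
        if y = a then (if y + unitVec j ∈ A then 1 else 0) else 0 := by
      intro a
      split_ifs with h h'
      · simp [h']
      · simp [h']
      · simp
    simp only [h4, Finset.sum_ite_eq]
    split_ifs <;> simp_all
  have h5 : ∑ j : Fin d, ∑ y : Site d n, (if y ∈ A ∧ y + unitVec j ∈ A then (1 : ℝ) else 0) =
      ∑ a ∈ A, ∑ b ∈ A, if a = b then 0 else ∑ j : Fin d, ∑ y : Site d n,
        if y = a ∧ y + unitVec j = b then 1 else 0 := by
    simp only [h3]
    have hy : ∀ j : Fin d, (∑ y : Site d n, ∑ a ∈ A, ∑ b ∈ A, if a = b then (0 : ℝ) else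
          if y = a ∧ y + unitVec j = b then 1 else 0) =
        ∑ a ∈ A, ∑ b ∈ A, if a = b then 0 else ∑ y : Site d n,
          if y = a ∧ y + unitVec j = b then 1 else 0 := by
      intro j
      rw [Finset.sum_comm]
      refine Finset.sum_congr rfl fun a _ => ?_
      rw [Finset.sum_comm]
      refine Finset.sum_congr rfl fun b _ => ?_
      by_cases h : a = b <;> simp [h]
    simp only [hy]
    rw [Finset.sum_comm]
    refine Finset.sum_congr rfl fun a _ => ?_
    rw [Finset.sum_comm]
    refine Finset.sum_congr rfl fun b _ => ?_
    by_cases h : a = b <;> simp [h]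
  rw [h2, h5]
  simp only [Finset.mul_sum, ← Finset.sum_add_distrib]
  refine Finset.sum_le_sum fun a _ => Finset.sum_le_sum fun b _ => ?_
  split_ifs with hab
  · simp
  · have := sum_green_swap_sub_le hn hab
    have h6 := mul_le_mul_of_nonneg_left this (by positivity : (0 : ℝ) ≤ 3 * d)
    simp only [Finset.mul_sum] at h6 ⊢
    refine (add_le_add_left h6 _).trans (le_of_eq ?_)
    rw [mul_sub]
    simp only [Finset.mul_sum]
    have h7 : ∀ x : ℝ, 3 * (d : ℝ) * (1 / (3 * d) * x) = x := fun x => by field_simp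
    simp only [h7]
    ring

/-- The recursive estimate for the correlation functions: those of `m + 2` sites are controlled by
those of `m` and of `m + 1` sites. -/
theorem IsForwardEvolution.abs_correlation_le (hφ : IsForwardEvolution φ) (hd : 1 ≤ d) (hn : 1 ≤ n)
    {T D v v' : ℝ} {m : ℕ} (hD : 0 ≤ D) (hv : 0 ≤ v) (hv' : 0 ≤ v')
    (hmean : ∀ t, 0 ≤ t → ∀ (j : Fin d) (x : Site d n),
      |mean φ t (x + unitVec j) - mean φ t x| ≤ D / (2 * n + 1))
    (h0 : ∀ A : Finset (Site d n), A.card = m + 2 → correlation φ 0 A = 0)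
    (h1 : ∀ t, 0 ≤ t → t ≤ T → ∀ A : Finset (Site d n), A.card = m → |correlation φ t A| ≤ v)
    (h2 : ∀ t, 0 ≤ t → t ≤ T → ∀ A : Finset (Site d n), A.card = m + 1 →
      |correlation φ t A| ≤ v')
    {t : ℝ} (ht : 0 ≤ t) (htT : t ≤ T) {A : Finset (Site d n)} (hA : A.card = m + 2) :
    |correlation φ t A| ≤ 3 * d * ((m : ℝ) + 2) ^ 2 *
      (2 * green (0 : Site d n) + T * ((2 * (n : ℝ) + 1) ^ d)⁻¹) *
        (D ^ 2 * v + 4 * D * (2 * n + 1) * v') := by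
  set M : ℝ := 2 * (n : ℝ) + 1 with hM
  have hMpos : 0 < M := by positivity
  set σ : ℝ := D ^ 2 * v + 4 * D * M * v' with hσ
  have hσ0 : 0 ≤ σ := by positivity
  have key : ∀ s : ℝ, |s| = 1 → s * correlation φ t A - 3 * d * σ * barrier t A ≤ 0 := by
    intro s hs
    -- Stirring preserves cardinality, so the sets of `m + 2` sites form a closed finite state
    -- space.
    refine parabolic_maximum_principle (α := {A : Finset (Site d n) // A.card = m + 2}) (T := T)
      (W := fun t A => s * correlation φ t A.1 - 3 * d * σ * barrier t A.1)
      (fun A t => ((hφ.hasDerivAt_correlation hn A.1 t).const_mul s).fun_sub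
        ((hasDerivAt_barrier t A.1).const_mul (3 * d * σ))) (fun A => ?_) ?_ t ht htT ⟨A, hA⟩
    · rw [h0 A.1 A.2, mul_zero, zero_sub, neg_nonpos]
      have := barrier_nonneg le_rfl A.1
      positivity
    · rintro r ⟨B, hB⟩ hr hrT hmax
      simp only at hmax ⊢
      have hbar := mul_le_mul_of_nonneg_left (sum_barrier_stir_sub_le hd hn r B) hσ0
      have hterm : ∀ (j : Fin d) (y : Site d n),
          s * ((correlation φ r (B.map (stir j y).toEmbedding) - correlation φ r B) +
            if y ∈ B ∧ y + unitVec j ∈ B then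
              -(mean φ r (y + unitVec j) - mean φ r y) ^ 2 *
                  correlation φ r ((B.erase y).erase (y + unitVec j)) +
                2 * (mean φ r (y + unitVec j) - mean φ r y) *
                  (correlation φ r (B.erase (y + unitVec j)) - correlation φ r (B.erase y))
            else 0) ≤
          3 * d * σ * (barrier r (B.map (stir j y).toEmbedding) - barrier r B) +
            σ / M ^ 2 * if y ∈ B ∧ y + unitVec j ∈ B then 1 else 0 := by
        intro j y
        -- Maximality at `B`, compared with the stirred set, bounds the stirring part of the
        -- correlation by that of the barrier.
        have hm := hmax ⟨B.map (stir j y).toEmbedding, by rw [Finset.card_map, hB]⟩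
        simp only at hm
        rw [mul_add]
        refine add_le_add (by linarith) ?_
        split_ifs with hy
        · have hδ := hmean r hr j y
          have hye := ne_add_unitVec hn j y
          have hc1 : (B.erase y).card = m + 1 := by
            rw [Finset.card_erase_of_mem hy.1, hB]
            rfl
          have hc2 : (B.erase (y + unitVec j)).card = m + 1 := by
            rw [Finset.card_erase_of_mem hy.2, hB]
            rfl
          have hc3 : ((B.erase y).erase (y + unitVec j)).card = m := by
            rw [Finset.card_erase_of_mem (Finset.mem_erase.2 ⟨hye.symm, hy.2⟩), hc1]
            rfl
          have hb1 := h2 r hr hrT _ hc1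
          have hb2 := h2 r hr hrT _ hc2
          have hb3 := h1 r hr hrT _ hc3
          set δ := mean φ r (y + unitVec j) - mean φ r y
          have hDM : 0 ≤ D / M := by positivity
          calc s * (-δ ^ 2 * correlation φ r ((B.erase y).erase (y + unitVec j)) +
                2 * δ * (correlation φ r (B.erase (y + unitVec j)) -
                  correlation φ r (B.erase y)))
              ≤ |s * (-δ ^ 2 * correlation φ r ((B.erase y).erase (y + unitVec j)) +
                2 * δ * (correlation φ r (B.erase (y + unitVec j)) -
                  correlation φ r (B.erase y)))| := le_abs_self _
            _ ≤ |δ| ^ 2 * |correlation φ r ((B.erase y).erase (y + unitVec j))| +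
                2 * |δ| * (|correlation φ r (B.erase (y + unitVec j))| +
                  |correlation φ r (B.erase y)|) := by
                rw [abs_mul, hs, one_mul]
                refine (abs_add_le _ _).trans (add_le_add ?_ ?_)
                · rw [abs_mul, abs_neg, abs_pow]
                · rw [abs_mul, abs_mul, abs_two]
                  gcongr
                  exact abs_sub _ _
            _ ≤ (D / M) ^ 2 * v + 2 * (D / M) * (v' + v') := by
                gcongr
            _ = σ / M ^ 2 * 1 := by
                rw [hσ]
                field_simp
                ring
        · simp
      rw [sub_nonpos]
      calc s * (M ^ 2 / 2 * ∑ j : Fin d, ∑ y : Site d n,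
              ((correlation φ r (B.map (stir j y).toEmbedding) - correlation φ r B) +
                if y ∈ B ∧ y + unitVec j ∈ B then
                  -(mean φ r (y + unitVec j) - mean φ r y) ^ 2 *
                      correlation φ r ((B.erase y).erase (y + unitVec j)) +
                    2 * (mean φ r (y + unitVec j) - mean φ r y) *
                      (correlation φ r (B.erase (y + unitVec j)) - correlation φ r (B.erase y))
                else 0))
          ≤ M ^ 2 / 2 * ∑ j : Fin d, ∑ y : Site d n,
            (3 * d * σ * (barrier r (B.map (stir j y).toEmbedding) - barrier r B) +
              σ / M ^ 2 * if y ∈ B ∧ y + unitVec j ∈ B then 1 else 0) := by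
            rw [mul_left_comm]
            refine mul_le_mul_of_nonneg_left ?_ (by positivity)
            simp only [Finset.mul_sum]
            exact Finset.sum_le_sum fun j _ => Finset.sum_le_sum fun y _ => hterm j y
        _ = σ * (3 * d * (M ^ 2 / 2 * ∑ j : Fin d, ∑ y : Site d n,
              (barrier r (B.map (stir j y).toEmbedding) - barrier r B))) +
            σ / 2 * ∑ j : Fin d, ∑ y : Site d n,
              (if y ∈ B ∧ y + unitVec j ∈ B then (1 : ℝ) else 0) := by
            simp only [Finset.sum_add_distrib, ← Finset.mul_sum]
            field_simp
        _ ≤ σ * (3 * d * (M ^ 2 / 2 * ∑ j : Fin d, ∑ y : Site d n,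
              (barrier r (B.map (stir j y).toEmbedding) - barrier r B)) +
            ∑ j : Fin d, ∑ y : Site d n,
              (if y ∈ B ∧ y + unitVec j ∈ B then (1 : ℝ) else 0)) := by
            rw [mul_add]
            have : 0 ≤ ∑ j : Fin d, ∑ y : Site d n,
              (if y ∈ B ∧ y + unitVec j ∈ B then (1 : ℝ) else 0) :=
              Finset.sum_nonneg fun j _ => Finset.sum_nonneg fun y _ => by split_ifs <;> norm_num
            nlinarith
        _ ≤ _ := by
            refine hbar.trans (le_of_eq ?_)
            ring
  have hle : |correlation φ t A| ≤ 3 * d * σ * barrier t A := by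
    rw [abs_le]
    constructor
    · have := key (-1) (by simp)
      linarith
    · have := key 1 (by simp)
      linarith
  refine hle.trans ?_
  have hb : barrier t A ≤ ((m : ℝ) + 2) ^ 2 *
      (2 * green (0 : Site d n) + T * (M ^ d)⁻¹) := by
    refine (barrier_le ht A).trans ?_
    rw [hA]
    push_cast
    gcongr
  calc 3 * d * σ * barrier t A ≤ 3 * d * σ * (((m : ℝ) + 2) ^ 2 *
      (2 * green (0 : Site d n) + T * (M ^ d)⁻¹)) := by gcongr
    _ = _ := by ring

end SSEP

/-! ### Four-point correlations -/

namespace SSEP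

/-- Products of two, and rescaled products of three, contact rates beat the rate of convergence. -/
theorem two_mul_contactRate_ge {d : ℕ} (hd : 1 ≤ d) :
    2 * min ((d : ℝ) / 2) 1 ≤ 2 * contactRate d ∧
      2 * min ((d : ℝ) / 2) 1 ≤ 3 * contactRate d - 2 := by
  unfold contactRate
  split_ifs with h
  · subst h
    have := min_le_left (((1 : ℕ) : ℝ) / 2) 1
    norm_num at this ⊢
  · have := min_le_right ((d : ℝ) / 2) 1
    constructor <;> linarith

/-- The correlation functions of four sites are of order `n^{-(d ∧ 2)}`. -/
theorem exists_abs_correlation_four_le {d : ℕ} (hd : 1 ≤ d) {T D : ℝ} (hT : 0 ≤ T) (hD : 0 ≤ D) :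
    ∃ C : ℝ, 0 ≤ C ∧ ∀ n : ℕ, 1 ≤ n → ∀ φ : ℝ → (Config d n → ℝ) →L[ℝ] ℝ,
      IsForwardEvolution φ →
      (∀ (j : Fin d) (x : Site d n), |mean φ 0 (x + unitVec j) - mean φ 0 x| ≤ D / (2 * n + 1)) →
      (∀ A : Finset (Site d n), A.Nonempty → correlation φ 0 A = 0) →
      ∀ t, 0 ≤ t → t ≤ T → ∀ A : Finset (Site d n), A.card = 4 →
        |correlation φ t A| ≤ C * (n : ℝ) ^ (-(2 * min ((d : ℝ) / 2) 1)) := by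
  obtain ⟨G, hG, hgreen⟩ := exists_green_zero_le hd
  set C₁ : ℝ := 2 * G + T with hC₁
  -- The factors 12, 27 and 48 are 3(m+2)² for m = 0, 1, 2; each 12 D is 4 D · 3, from 2n+1 ≤ 3n.
  set C₂ : ℝ := 12 * d * C₁ * D ^ 2 with hC₂
  set C₃ : ℝ := 27 * d * C₁ * (12 * D * C₂) with hC₃
  have hC₁0 : 0 ≤ C₁ := by positivity
  have hC₂0 : 0 ≤ C₂ := by positivity
  have hC₃0 : 0 ≤ C₃ := by positivity
  refine ⟨48 * d * C₁ * (D ^ 2 * C₂ + 12 * D * C₃), by positivity, ?_⟩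
  intro n hn φ hφ hgrad hinit t ht htT A hA
  have hn' : (1 : ℝ) ≤ n := by exact_mod_cast hn
  set ν : ℝ := (n : ℝ) ^ (-contactRate d) with hν
  have hν0 : 0 ≤ ν := by positivity
  set a : ℝ := 2 * green (0 : Site d n) + T * ((2 * (n : ℝ) + 1) ^ d)⁻¹ with ha
  have hag := green_zero_nonneg (d := d) (n := n)
  have ha0 : 0 ≤ a := by positivity
  have haν : a ≤ C₁ * ν := by
    have h1 := hgreen n hn
    have h2 := mul_le_mul_of_nonneg_left (inv_pow_le_contactRate hd hn) hT
    rw [ha, hC₁, add_mul]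
    linarith
  have hM : 2 * (n : ℝ) + 1 ≤ 3 * n := by linarith
  have hmean : ∀ t, 0 ≤ t → ∀ (j : Fin d) (x : Site d n),
      |mean φ t (x + unitVec j) - mean φ t x| ≤ D / (2 * n + 1) := fun t ht j x =>
    hφ.abs_mean_add_sub_le hn j (hgrad j) ht x
  have hzero : ∀ m, ∀ B : Finset (Site d n), B.card = m + 2 → correlation φ 0 B = 0 :=
    fun m B hB => hinit B (Finset.card_pos.1 (by omega))
  have hcorr1 : ∀ t, 0 ≤ t → t ≤ T → ∀ B : Finset (Site d n), B.card = 1 →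
      |correlation φ t B| ≤ 0 := by
    intro t ht _ B hB
    obtain ⟨x, rfl⟩ := Finset.card_eq_one.1 hB
    rw [hφ.correlation_singleton ht, abs_zero]
  have hcorr2 : ∀ t, 0 ≤ t → t ≤ T → ∀ B : Finset (Site d n), B.card = 2 →
      |correlation φ t B| ≤ C₂ * ν := by
    intro t ht htT B hB
    have := hφ.abs_correlation_le hd hn (T := T) (m := 0) (v := 1) (v' := 0) hD zero_le_one le_rfl
      hmean (hzero 0)
      (fun t ht _ B hB => by
        rw [Finset.card_eq_zero.1 hB, hφ.correlation_empty ht, abs_one])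
      hcorr1 ht htT hB
    refine this.trans ?_
    rw [← ha]
    calc _ = 12 * d * a * D ^ 2 := by push_cast; ring
      _ ≤ 12 * d * (C₁ * ν) * D ^ 2 := by gcongr
      _ = C₂ * ν := by rw [hC₂]; ring
  have hcorr3 : ∀ t, 0 ≤ t → t ≤ T → ∀ B : Finset (Site d n), B.card = 3 →
      |correlation φ t B| ≤ C₃ * (n * ν ^ 2) := by
    intro t ht htT B hB
    have := hφ.abs_correlation_le hd hn (T := T) (m := 1) (v := 0) (v' := C₂ * ν) hD le_rfl
      (by positivity) hmean (hzero 1) hcorr1 hcorr2 ht htT hB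
    refine this.trans ?_
    rw [← ha]
    calc _ = 27 * d * a * (4 * D * (2 * n + 1) * (C₂ * ν)) := by push_cast; ring
      _ ≤ 27 * d * (C₁ * ν) * (4 * D * (3 * n) * (C₂ * ν)) := by gcongr
      _ = C₃ * (n * ν ^ 2) := by rw [hC₃]; ring
  have hcorr4 := hφ.abs_correlation_le hd hn (T := T) (m := 2) (v := C₂ * ν)
      (v' := C₃ * (n * ν ^ 2)) hD (by positivity)
      (by positivity) hmean (hzero 2) hcorr2 hcorr3 ht htT hA
  refine hcorr4.trans ?_
  rw [← ha]
  obtain ⟨hr1, hr2⟩ := two_mul_contactRate_ge hd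
  have hν2 : ν ^ 2 ≤ (n : ℝ) ^ (-(2 * min ((d : ℝ) / 2) 1)) := by
    rw [hν, ← Real.rpow_natCast, ← Real.rpow_mul (by positivity)]
    refine Real.rpow_le_rpow_of_exponent_le hn' ?_
    push_cast
    linarith
  -- The critical term when d = 1: n²ν³ = n^{-1}. For d ≥ 2 any contact rate of at least 4/3 would
  -- do.
  have hν3 : (n : ℝ) ^ 2 * ν ^ 3 ≤ (n : ℝ) ^ (-(2 * min ((d : ℝ) / 2) 1)) := by
    rw [hν, ← Real.rpow_natCast, ← Real.rpow_natCast, ← Real.rpow_mul (by positivity),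
      ← Real.rpow_add (by positivity)]
    refine Real.rpow_le_rpow_of_exponent_le hn' ?_
    push_cast
    linarith
  calc _ = 48 * d * a * (D ^ 2 * (C₂ * ν) + 4 * D * (2 * n + 1) * (C₃ * (n * ν ^ 2))) := by
        push_cast
        ring
    _ ≤ 48 * d * (C₁ * ν) * (D ^ 2 * (C₂ * ν) + 4 * D * (3 * n) * (C₃ * (n * ν ^ 2))) := by
        gcongr
    _ = 48 * d * C₁ * (D ^ 2 * C₂ * ν ^ 2 + 12 * D * C₃ * (n ^ 2 * ν ^ 3)) := by ring
    _ ≤ 48 * d * C₁ * (D ^ 2 * C₂ * (n : ℝ) ^ (-(2 * min ((d : ℝ) / 2) 1)) +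
          12 * D * C₃ * (n : ℝ) ^ (-(2 * min ((d : ℝ) / 2) 1))) := by gcongr
    _ = _ := by ring

end SSEP

namespace SSEP

/-! ### The exclusion process -/

variable {d n : ℕ} {Ω : Type*} [MeasurableSpace Ω] {μ : Measure Ω} {η : ℝ≥0 → Ω → Config d n}

/-- Integration against the law of a random configuration. -/
def lawFunctional (μ : Measure Ω) (ξ : Ω → Config d n) : (Config d n → ℝ) →L[ℝ] ℝ :=
  ∑ c, (μ.map ξ).real {c} • ContinuousLinearMap.proj (R := ℝ) (φ := fun _ : Config d n => ℝ) c

theorem lawFunctional_apply [IsProbabilityMeasure μ] {ξ : Ω → Config d n} (hξ : Measurable ξ)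
    (F : Config d n → ℝ) : lawFunctional μ ξ F = ∫ ω, F (ξ ω) ∂μ := by
  have : IsFiniteMeasure (μ.map ξ) := inferInstance
  have hF : Integrable F (μ.map ξ) := Integrable.of_finite
  rw [← integral_map hξ.aemeasurable hF.aestronglyMeasurable, integral_fintype hF]
  simp [lawFunctional]

theorem integrable_comp_config [IsFiniteMeasure μ] {E : Type*} [NormedAddCommGroup E]
    {ξ : Ω → Config d n} (hξ : Measurable ξ) (F : Config d n → E) :
    Integrable (fun ω => F (ξ ω)) μ :=
  (Integrable.of_finite (f := F) (μ := μ.map ξ)).comp_measurable hξ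

/-- The evolution of the law of the exclusion process under the forward equation. -/
def lawEvolution (μ : Measure Ω) (η : ℝ≥0 → Ω → Config d n) (t : ℝ) :
    (Config d n → ℝ) →L[ℝ] ℝ :=
  (lawFunctional μ (η 0)).comp
    (NormedSpace.exp (t • LinearMap.toContinuousLinearMap (generator d n)))

/-- The Markov property from time 0, integrated, removes the conditional expectation. -/
theorem IsSSEP.lawEvolution_apply [IsProbabilityMeasure μ] (hη : IsSSEP μ η) (t : ℝ≥0)
    (F : Config d n → ℝ) : lawEvolution μ η t F = ∫ ω, F (η t ω) ∂μ := by
  have hle : pastSigma η 0 ≤ (inferInstance : MeasurableSpace Ω) :=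
    iSup_le fun r => iSup_le fun _ => (hη.measurable r).comap_le
  have h := integral_congr_ae (hη.markov 0 t F)
  rw [integral_condExp hle, zero_add] at h
  rw [h, lawEvolution, ContinuousLinearMap.comp_apply, lawFunctional_apply (hη.measurable 0)]
  rfl

theorem hasDerivAt_lawEvolution (t : ℝ) :
    HasDerivAt (lawEvolution μ η) ((lawEvolution μ η t).comp
      (LinearMap.toContinuousLinearMap (generator d n))) t := by
  have h := hasDerivAt_exp_smul_const (𝕂 := ℝ)
    (LinearMap.toContinuousLinearMap (generator d n)) t
  have h2 := (hasDerivAt_const t (lawFunctional μ (η 0))).clm_comp h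
  refine HasDerivAt.congr_deriv h2 ?_
  ext F
  simp [lawEvolution]

theorem IsSSEP.isForwardEvolution [IsProbabilityMeasure μ] (hη : IsSSEP μ η) :
    IsForwardEvolution (lawEvolution μ η) where
  hasDerivAt := hasDerivAt_lawEvolution
  map_one t ht := by
    refine (hη.lawEvolution_apply ⟨t, ht⟩ fun _ => 1).trans ?_
    simp

theorem IsSSEP.mean_lawEvolution [IsProbabilityMeasure μ] (hη : IsSSEP μ η) (t : ℝ≥0)
    (x : Site d n) : mean (lawEvolution μ η) t x = meanField μ η t x :=
  hη.lawEvolution_apply t _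

theorem IsSSEP.correlation_lawEvolution [IsProbabilityMeasure μ] (hη : IsSSEP μ η) (t : ℝ≥0)
    (A : Finset (Site d n)) : correlation (lawEvolution μ η) t A =
      ∫ ω, ∏ a ∈ A, (occ (η t ω) a - meanField μ η t a) ∂μ := by
  simp only [correlation, hη.mean_lawEvolution]
  exact hη.lawEvolution_apply t _

theorem integral_occ_sub_meanField [IsProbabilityMeasure μ] (hη : IsSSEP μ η) (t : ℝ≥0)
    (x : Site d n) : ∫ ω, (occ (η t ω) x - meanField μ η t x) ∂μ = 0 := by
  rw [integral_sub (integrable_comp_config (hη.measurable t) fun c => occ c x)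
    (integrable_const _)]
  simp [meanField]

/-- Independence factorizes the expectation, and each factor has mean zero; sites outside `A` carry
the factor 1. -/
theorem IsSSEP.correlation_zero [IsProbabilityMeasure μ] (hη : IsSSEP μ η)
    (hind : iIndepFun (fun x ω => η 0 ω x) μ) {A : Finset (Site d n)} (hA : A.Nonempty) :
    correlation (lawEvolution μ η) 0 A = 0 := by
  have h := hη.correlation_lawEvolution 0 A
  rw [NNReal.coe_zero] at h
  rw [h]
  have h2 := hind.integral_fun_prod_comp (𝕜 := ℝ)
    (f := fun x b => if x ∈ A then (if b = true then 1 else 0) - meanField μ η 0 x else 1)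
    (fun x => ((measurable_pi_apply x).comp (hη.measurable 0)).aemeasurable)
    (fun x => (measurable_of_finite _).aestronglyMeasurable)
  have h3 : ∀ ω, ∏ a ∈ A, (occ (η 0 ω) a - meanField μ η 0 a) =
      ∏ x, if x ∈ A then (if η 0 ω x = true then 1 else 0) - meanField μ η 0 x else 1 := by
    intro ω
    rw [Finset.prod_ite_mem, Finset.univ_inter]
    rfl
  simp only [h3]
  rw [h2]
  obtain ⟨a, ha⟩ := hA
  refine Finset.prod_eq_zero (Finset.mem_univ a) ?_
  simp only [ha, if_true]
  exact integral_occ_sub_meanField hη 0 a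

theorem occ_mem_Icc (c : Config d n) (x : Site d n) : occ c x ∈ Set.Icc (0 : ℝ) 1 := by
  unfold occ
  split_ifs <;> simp

theorem meanField_mem_Icc [IsProbabilityMeasure μ] (hη : IsSSEP μ η) (t : ℝ≥0) (x : Site d n) :
    meanField μ η t x ∈ Set.Icc (0 : ℝ) 1 := by
  have h := integral_mono (μ := μ) (integrable_comp_config (hη.measurable t) fun c => occ c x)
    (integrable_const (1 : ℝ)) fun ω => (occ_mem_Icc (η t ω) x).2
  exact ⟨integral_nonneg fun ω => (occ_mem_Icc (η t ω) x).1, by simpa [meanField] using h⟩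

theorem meanField_zero [IsProbabilityMeasure μ] (hη : IsSSEP μ η) {ρ₀ : Site d n → ℝ}
    (hρ : ∀ x, 0 ≤ ρ₀ x) (hstart : IsBernoulliStart μ η ρ₀) (x : Site d n) :
    meanField μ η 0 x = ρ₀ x := by
  have hm : MeasurableSet {ω | η 0 ω x = true} :=
    ((measurable_pi_apply x).comp (hη.measurable 0)) (measurableSet_singleton true)
  have : (fun ω => occ (η 0 ω) x) = Set.indicator {ω | η 0 ω x = true} 1 := by
    funext ω
    simp [occ, Set.indicator_apply]
  rw [meanField, this, integral_indicator_one hm, measureReal_def, hstart.prob_occupied,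
    ENNReal.toReal_ofReal (hρ x)]

theorem abs_add_unitVec_sub_le (f : Site d n → ℝ) {K : ℝ} (hK : discreteGradNorm f ≤ K)
    (j : Fin d) (x : Site d n) :
    |f (x + unitVec j) - f x| ≤ 2 * Real.pi * K / (2 * n + 1) := by
  have h1 : ‖discreteGrad f x j‖ ≤ ‖discreteGrad f x‖ := PiLp.norm_apply_le _ j
  have h2 : ‖discreteGrad f x‖ ≤ discreteGradNorm f :=
    le_ciSup (f := fun x => ‖discreteGrad f x‖) (Set.finite_range _).bddAbove x
  have h3 := h1.trans (h2.trans hK)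
  have hM : (0 : ℝ) < 2 * n + 1 := by positivity
  have hpi := Real.pi_pos
  rw [discreteGrad, Real.norm_eq_abs, abs_mul, abs_of_pos (by positivity)] at h3
  rw [le_div_iff₀ hM]
  rw [div_mul_eq_mul_div, div_le_iff₀ (by positivity)] at h3
  linarith

/-- The centered occupation numbers. -/
def centered (μ : Measure Ω) (η : ℝ≥0 → Ω → Config d n) (t : ℝ≥0) (c : Config d n)
    (x : Site d n) : ℝ :=
  occ c x - meanField μ η t x

theorem abs_centered_le [IsProbabilityMeasure μ] (hη : IsSSEP μ η) (t : ℝ≥0) (c : Config d n)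
    (x : Site d n) : |centered μ η t c x| ≤ 1 := by
  have h1 := occ_mem_Icc c x
  have h2 := meanField_mem_Icc hη t x
  rw [centered, abs_le]
  constructor <;> linarith [h1.1, h1.2, h2.1, h2.2]

/-- The second moment of a linear combination of products of neighbouring centered occupation
numbers, in terms of a bound for the four point correlations. -/
theorem integral_norm_sq_sum_le [IsProbabilityMeasure μ] (hη : IsSSEP μ η) (hn : 1 ≤ n) (t : ℝ≥0)
    (j : Fin d) {v : ℝ} (hv : 0 ≤ v)
    (hcorr : ∀ A : Finset (Site d n), A.card = 4 → |correlation (lawEvolution μ η) t A| ≤ v)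
    (χ : Site d n → ℂ) (hχ : ∀ x, ‖χ x‖ ≤ 1) :
    ∫ ω, ‖∑ x, ((centered μ η t (η t ω) * shift j (centered μ η t (η t ω))) x : ℂ) * χ x‖ ^ 2
      ∂μ ≤ 3 * (2 * n + 1) ^ d + ((2 * n + 1) ^ d) ^ 2 * v := by
  set X : Ω → Site d n → ℝ := fun ω => centered μ η t (η t ω) with hX
  have hexp : ∀ ω, ‖∑ x, ((X ω * shift j (X ω)) x : ℂ) * χ x‖ ^ 2 =
      ∑ x, ∑ y, (X ω x * X ω (x + unitVec j) * (X ω y * X ω (y + unitVec j))) *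
        (χ x * conj (χ y)).re := by
    intro ω
    have h1 : ∀ z : ℂ, ‖z‖ ^ 2 = (z * conj z).re := by
      intro z
      rw [Complex.mul_conj, Complex.ofReal_re, Complex.normSq_eq_norm_sq]
    rw [h1, map_sum, Finset.sum_mul_sum, Complex.re_sum]
    refine Finset.sum_congr rfl fun x _ => ?_
    rw [Complex.re_sum]
    refine Finset.sum_congr rfl fun y _ => ?_
    rw [map_mul, Complex.conj_ofReal, mul_mul_mul_comm, ← Complex.ofReal_mul,
      Complex.re_ofReal_mul]
    rfl
  have hint : ∀ x y, Integrable (fun ω =>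
      X ω x * X ω (x + unitVec j) * (X ω y * X ω (y + unitVec j))) μ := fun x y =>
    integrable_comp_config (hη.measurable t) fun c =>
      centered μ η t c x * centered μ η t c (x + unitVec j) *
        (centered μ η t c y * centered μ η t c (y + unitVec j))
  have hχ2 : ∀ x y, |(χ x * conj (χ y)).re| ≤ 1 := by
    intro x y
    refine (Complex.abs_re_le_norm _).trans ?_
    rw [norm_mul, RCLike.norm_conj]
    exact mul_le_one₀ (hχ x) (norm_nonneg _) (hχ y)
  have hle1 : ∀ ω x, |X ω x| ≤ 1 := fun ω x => abs_centered_le hη t _ x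
  -- The two neighbour pairs meet only if `y` is `x`, `x + e` or `x - e`; then the integrand is
  -- bounded by 1. Otherwise the four sites are distinct.
  have hpair : ∀ x y,
      |∫ ω, X ω x * X ω (x + unitVec j) * (X ω y * X ω (y + unitVec j)) ∂μ| ≤
        ((if y = x then 1 else 0) + (if y = x + unitVec j then 1 else 0) +
          (if y = x - unitVec j then 1 else 0)) + v := by
    intro x y
    have hnn : ∀ p : Prop, ∀ [Decidable p], (0 : ℝ) ≤ if p then 1 else 0 := by
      intro p _
      split_ifs <;> norm_num
    by_cases h : y = x ∨ y = x + unitVec j ∨ y = x - unitVec j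
    · have hb : |∫ ω, X ω x * X ω (x + unitVec j) * (X ω y * X ω (y + unitVec j)) ∂μ| ≤ 1 := by
        rw [← Real.norm_eq_abs]
        refine (norm_integral_le_of_norm_le_const (μ := μ) (C := (1 : ℝ))
          (.of_forall fun ω => ?_)).trans ?_
        · rw [Real.norm_eq_abs, abs_mul, abs_mul, abs_mul]
          exact mul_le_one₀ (mul_le_one₀ (hle1 _ _) (abs_nonneg _) (hle1 _ _)) (by positivity)
            (mul_le_one₀ (hle1 _ _) (abs_nonneg _) (hle1 _ _))
        · simp
      have h1 := hnn (y = x)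
      have h2 := hnn (y = x + unitVec j)
      have h3 := hnn (y = x - unitVec j)
      rcases h with h | h | h
      · rw [if_pos h]
        linarith
      · rw [if_pos h]
        linarith
      · rw [if_pos h]
        linarith
    · push Not at h
      obtain ⟨h1, h2, h3⟩ := h
      have he := unitVec_ne_zero hn j
      have hx := ne_add_unitVec hn j x
      have hy := ne_add_unitVec hn j y
      have h4 : x ≠ y + unitVec j := fun h => h3 (eq_sub_of_add_eq h.symm)
      have h5 : x + unitVec j ≠ y + unitVec j := fun h => h1 (add_right_cancel h).symm
      have hn1 : x ∉ ({x + unitVec j, y, y + unitVec j} : Finset (Site d n)) := by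
        simp only [Finset.mem_insert, Finset.mem_singleton, not_or]
        exact ⟨hx, h1.symm, h4⟩
      have hn2 : x + unitVec j ∉ ({y, y + unitVec j} : Finset (Site d n)) := by
        simp only [Finset.mem_insert, Finset.mem_singleton, not_or]
        exact ⟨h2.symm, h5⟩
      have hn3 : y ∉ ({y + unitVec j} : Finset (Site d n)) := by
        simpa only [Finset.mem_singleton] using hy
      have hc := hcorr {x, x + unitVec j, y, y + unitVec j} (by
        rw [Finset.card_insert_of_notMem hn1, Finset.card_insert_of_notMem hn2,
          Finset.card_insert_of_notMem hn3, Finset.card_singleton])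
      rw [hη.correlation_lawEvolution] at hc
      simp only [Finset.prod_insert hn1, Finset.prod_insert hn2, Finset.prod_insert hn3,
        Finset.prod_singleton, ← mul_assoc] at hc
      rw [if_neg h1, if_neg h2, if_neg h3]
      simpa [hX, centered, ← mul_assoc] using hc
  refine (integral_congr_ae (.of_forall hexp)).trans_le ?_
  rw [integral_finsetSum _ fun x _ => integrable_finsetSum _ fun y _ => (hint x y).mul_const _]
  have hcard : (Fintype.card (Site d n) : ℝ) = (2 * n + 1) ^ d := by
    rw [Fintype.card_pi]
    simp [ZMod.card]
  calc ∑ x, ∫ ω, ∑ y, (X ω x * X ω (x + unitVec j) * (X ω y * X ω (y + unitVec j))) *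
        (χ x * conj (χ y)).re ∂μ
      = ∑ x, ∑ y, (∫ ω, X ω x * X ω (x + unitVec j) * (X ω y * X ω (y + unitVec j)) ∂μ) *
        (χ x * conj (χ y)).re := by
        refine Finset.sum_congr rfl fun x _ => ?_
        rw [integral_finsetSum _ fun y _ => (hint x y).mul_const _]
        exact Finset.sum_congr rfl fun y _ => integral_mul_const _ _
    _ ≤ ∑ x : Site d n, ∑ y : Site d n,
        (((if y = x then 1 else 0) + (if y = x + unitVec j then 1 else 0) +
          (if y = x - unitVec j then 1 else 0)) + v) := by
        refine Finset.sum_le_sum fun x _ => Finset.sum_le_sum fun y _ => ?_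
        refine (le_abs_self _).trans ?_
        rw [abs_mul]
        exact (mul_le_of_le_one_right (abs_nonneg _) (hχ2 x y)).trans (hpair x y)
    _ = _ := by
        simp only [Finset.sum_add_distrib, Finset.sum_ite_eq', Finset.mem_univ, if_true,
          Finset.sum_const, Finset.card_univ, nsmul_eq_mul, hcard]
        ring

end SSEP

namespace SSEP

/-! ### Pairing with elements of the Sobolev space -/

variable {d n : ℕ} {J : ℝ}

theorem Sobolev.weight_mul_norm_sq_fourierCoef_le (f : Sobolev d J) (S : Finset (Fin d → ℤ)) :
    ∑ k ∈ S, weight k ^ J * ‖fourierCoef f.toL2 k‖ ^ 2 ≤ ‖f‖ ^ 2 := by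
  rw [Sobolev.norm_sq_eq]
  exact Summable.sum_le_tsum S
    (fun k _ => mul_nonneg (Real.rpow_nonneg (weight_pos k).le _) (sq_nonneg _)) f.mem

theorem Sobolev.norm_fourierCoef_le (f : Sobolev d J) (k : Fin d → ℤ) :
    ‖fourierCoef f.toL2 k‖ ≤ weight k ^ (-(J / 2)) * ‖f‖ := by
  have h := f.weight_mul_norm_sq_fourierCoef_le {k}
  rw [Finset.sum_singleton] at h
  have hw := weight_pos k
  refine le_of_sq_le_sq ?_ (by positivity)
  have h2 : (weight k ^ (-(J / 2))) ^ 2 * weight k ^ J = 1 := by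
    rw [← Real.rpow_natCast, ← Real.rpow_mul hw.le, ← Real.rpow_add hw]
    norm_num
  calc ‖fourierCoef f.toL2 k‖ ^ 2
      = (weight k ^ (-(J / 2))) ^ 2 * (weight k ^ J * ‖fourierCoef f.toL2 k‖ ^ 2) := by
        rw [← mul_assoc, h2, one_mul]
    _ ≤ (weight k ^ (-(J / 2))) ^ 2 * ‖f‖ ^ 2 := by gcongr
    _ = _ := by ring

/-- Transfers measurability from the random element `f` to its Fourier coefficients. -/
theorem Sobolev.continuous_fourierCoef (k : Fin d → ℤ) :
    Continuous fun f : Sobolev d J => fourierCoef f.toL2 k := by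
  let L : Sobolev d J →ₗ[ℝ] ℂ :=
    { toFun := fun f => fourierCoef f.toL2 k
      map_add' := fun f g => fourierCoef_add f.toL2 g.toL2 k
      map_smul' := fun c f => fourierCoef_smul c f.toL2 k }
  exact (L.mkContinuous (weight k ^ (-(J / 2))) fun f => f.norm_fourierCoef_le k).continuous

theorem pairing_ext (f : L2Torus d) (g : Site d n → ℝ) :
    pairing f (ext g) = ∑ k ∈ freqBox d n, (discreteCoef g k * conj (fourierCoef f k)).re := by
  have h1 : ((pairing f (ext g) : ℝ) : ℂ) =
      ∑ k ∈ freqBox d n, discreteCoef g k * conj (fourierCoef f k) := by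
    have hconj : ∀ k x, (f x : ℂ) * character k x = conj ((f x : ℂ) * conj (character k x)) := by
      intro k x
      rw [map_mul, Complex.conj_ofReal, Complex.conj_conj]
    have hint : ∀ k, Integrable (fun x => (f x : ℂ) * character k x) (torusMeasure d) := by
      intro k
      simp only [hconj]
      exact (Complex.conjCLE.integrable_comp_iff).2 (integrable_mul_character f k)
    rw [pairing, ← integral_complex_ofReal]
    calc ∫ x, ((f x * ext g x : ℝ) : ℂ) ∂(torusMeasure d)
        = ∫ x, ∑ k ∈ freqBox d n, discreteCoef g k * ((f x : ℂ) * character k x)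
            ∂(torusMeasure d) := by
          refine integral_congr_ae (.of_forall fun x => ?_)
          simp only [Complex.ofReal_mul, ext_eq, Finset.mul_sum]
          exact Finset.sum_congr rfl fun k _ => by ring
      _ = ∑ k ∈ freqBox d n, discreteCoef g k * ∫ x, (f x : ℂ) * character k x
            ∂(torusMeasure d) := by
          rw [integral_finsetSum _ fun k _ => (hint k).const_mul _]
          exact Finset.sum_congr rfl fun k _ => integral_const_mul _ _
      _ = _ := by
          refine Finset.sum_congr rfl fun k _ => ?_
          rw [fourierCoef, ← integral_conj]
          simp only [hconj]
  rw [← Complex.re_sum, ← h1, Complex.ofReal_re]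

/-- Duality between H_J and H_{-J}, by Cauchy–Schwarz with weights. -/
theorem abs_pairing_ext_le (f : Sobolev d J) (g : Site d n → ℝ) :
    |pairing f.toL2 (ext g)| ≤
      √(∑ k ∈ freqBox d n, weight k ^ (-J) * ‖discreteCoef g k‖ ^ 2) * ‖f‖ := by
  rw [pairing_ext]
  calc |∑ k ∈ freqBox d n, (discreteCoef g k * conj (fourierCoef f.toL2 k)).re|
      ≤ ∑ k ∈ freqBox d n, (weight k ^ (-(J / 2)) * ‖discreteCoef g k‖) *
          (weight k ^ (J / 2) * ‖fourierCoef f.toL2 k‖) := by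
        refine (Finset.abs_sum_le_sum_abs _ _).trans (Finset.sum_le_sum fun k _ => ?_)
        refine (Complex.abs_re_le_norm _).trans (le_of_eq ?_)
        rw [norm_mul, RCLike.norm_conj, mul_mul_mul_comm, ← Real.rpow_add (weight_pos k)]
        simp
    _ ≤ √(∑ k ∈ freqBox d n, (weight k ^ (-(J / 2)) * ‖discreteCoef g k‖) ^ 2) *
          √(∑ k ∈ freqBox d n, (weight k ^ (J / 2) * ‖fourierCoef f.toL2 k‖) ^ 2) :=
        Real.sum_mul_le_sqrt_mul_sqrt _ _ _
    _ ≤ √(∑ k ∈ freqBox d n, weight k ^ (-J) * ‖discreteCoef g k‖ ^ 2) * ‖f‖ := by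
        have hsq : ∀ (k : Fin d → ℤ) (s : ℝ), (weight k ^ (s / 2)) ^ 2 = weight k ^ s := by
          intro k s
          rw [← Real.rpow_natCast, ← Real.rpow_mul (weight_pos k).le]
          norm_num
        simp only [mul_pow, ← neg_div, hsq]
        gcongr
        rw [Real.sqrt_le_left (norm_nonneg _)]
        exact f.weight_mul_norm_sq_fourierCoef_le _

theorem discreteCoef_smul (c : ℝ) (g : Site d n → ℝ) (k : Fin d → ℤ) :
    discreteCoef (c • g) k = c * discreteCoef g k := by
  simp only [discreteCoef, Pi.smul_apply, smul_eq_mul, Complex.ofReal_mul, mul_assoc,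
    ← Finset.mul_sum]
  ring

theorem pairing_ext_smul (f : L2Torus d) (c : ℝ) (g : Site d n → ℝ) :
    pairing f (ext (c • g)) = c * pairing f (ext g) := by
  simp only [pairing_ext, discreteCoef_smul, mul_assoc, Complex.re_ofReal_mul, Finset.mul_sum]

theorem norm_sq_discreteCoef (g : Site d n → ℝ) (k : Fin d → ℤ) :
    ‖discreteCoef g k‖ ^ 2 = (((2 * (n : ℝ) + 1) ^ d)⁻¹) ^ 2 *
      ‖∑ x : Site d n, (g x : ℂ) * conj (character k x.point)‖ ^ 2 := by
  have : ‖((2 * (n : ℂ) + 1) ^ d)⁻¹‖ = ((2 * (n : ℝ) + 1) ^ d)⁻¹ := by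
    rw [norm_inv, norm_pow]
    congr 2
    have : (2 * (n : ℂ) + 1) = ((2 * (n : ℝ) + 1 : ℝ) : ℂ) := by push_cast; rfl
    rw [this, Complex.norm_real, Real.norm_of_nonneg (by positivity)]
  rw [discreteCoef, norm_mul, this, mul_pow]

end SSEP

/-! ### Cauchy–Schwarz over the probability space -/

namespace SSEP

variable {d n : ℕ} {J : ℝ} {Ω : Type*} [MeasurableSpace Ω] {μ : Measure Ω}
  {η : ℝ≥0 → Ω → Config d n}

/-- The product of the centered occupation numbers at neighbouring sites. -/
def neighbourProduct (μ : Measure Ω) (η : ℝ≥0 → Ω → Config d n) (t : ℝ≥0) (j : Fin d)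
    (c : Config d n) : Site d n → ℝ :=
  centered μ η t c * shift j (centered μ η t c)

theorem fluctuation_mul_shift (t : ℝ≥0) (j : Fin d) (ω : Ω) :
    fluctuation μ η t ω * shift j (fluctuation μ η t ω) =
      (2 * (n : ℝ) + 1) ^ d • neighbourProduct μ η t j (η t ω) := by
  have h : ((2 * (n : ℝ) + 1) ^ d : ℝ) =
      (2 * (n : ℝ) + 1) ^ ((d : ℝ) / 2) * (2 * (n : ℝ) + 1) ^ ((d : ℝ) / 2) := by
    rw [← Real.rpow_add (by positivity), add_halves, Real.rpow_natCast]
  funext x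
  simp only [neighbourProduct, Pi.mul_apply, Pi.smul_apply, smul_eq_mul, shift, fluctuation,
    centered, h]
  ring

theorem memLp_norm_sobolev {f : Ω → Sobolev d J} (hf : MemLp f 2 μ) :
    MemLp (fun ω => ‖f ω‖) 2 μ := by
  refine ⟨continuous_norm.comp_aestronglyMeasurable hf.1, ?_⟩
  have : eLpNorm (fun ω => ‖f ω‖) 2 μ = eLpNorm f 2 μ := by
    simp [eLpNorm, eLpNorm', enorm_norm]
  rw [this]
  exact hf.2

/-- The discrete coefficients take finitely many values, and those of `f` are dominated by its norm.
-/
theorem integrable_pairing [IsProbabilityMeasure μ] (hη : IsSSEP μ η) {f : Ω → Sobolev d J}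
    (hf : MemLp f 2 μ) (t : ℝ≥0) (g : Config d n → Site d n → ℝ) :
    Integrable (fun ω => pairing (f ω).toL2 (ext (g (η t ω)))) μ := by
  have hcoef : ∀ k, Integrable (fun ω => fourierCoef (f ω).toL2 k) μ := by
    intro k
    refine Integrable.mono' (((memLp_norm_sobolev hf).integrable one_le_two).const_mul (weight k ^ (-(J / 2))))
      ((Sobolev.continuous_fourierCoef k).comp_aestronglyMeasurable hf.1)
      (.of_forall fun ω => (f ω).norm_fourierCoef_le k)
  simp only [pairing_ext]
  refine integrable_finsetSum _ fun k _ => ?_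
  obtain ⟨B, hB⟩ := (Set.finite_range fun c => ‖discreteCoef (g c) k‖).bddAbove
  have h : Integrable
      (fun ω => discreteCoef (g (η t ω)) k * conj (fourierCoef (f ω).toL2 k)) μ :=
    Integrable.bdd_mul (c := B) ((Complex.conjCLE.integrable_comp_iff).2 (hcoef k))
      (integrable_comp_config (hη.measurable t) fun c => discreteCoef (g c) k).1
      (.of_forall fun ω => hB ⟨η t ω, rfl⟩)
  exact h.re

theorem abs_integral_pairing_le [IsProbabilityMeasure μ] (hη : IsSSEP μ η) {f : Ω → Sobolev d J}
    (hf : MemLp f 2 μ) (t : ℝ≥0) (g : Config d n → Site d n → ℝ) :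
    |∫ ω, pairing (f ω).toL2 (ext (g (η t ω))) ∂μ| ≤
      (∑ k ∈ freqBox d n, weight k ^ (-J) * ∫ ω, ‖discreteCoef (g (η t ω)) k‖ ^ 2 ∂μ) ^
        ((1 : ℝ) / 2) * (∫ ω, ‖f ω‖ ^ 2 ∂μ) ^ ((1 : ℝ) / 2) := by
  set Y : Config d n → ℝ := fun c =>
    √(∑ k ∈ freqBox d n, weight k ^ (-J) * ‖discreteCoef (g c) k‖ ^ 2) with hY
  have hY2 : ∀ c, Y c ^ (2 : ℝ) =
      ∑ k ∈ freqBox d n, weight k ^ (-J) * ‖discreteCoef (g c) k‖ ^ 2 := by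
    intro c
    rw [Real.rpow_two, hY, Real.sq_sqrt]
    exact Finset.sum_nonneg fun k _ =>
      mul_nonneg (Real.rpow_nonneg (weight_pos k).le _) (sq_nonneg _)
  have hYmem : MemLp (fun ω => Y (η t ω)) (ENNReal.ofReal 2) μ := by
    obtain ⟨B, hB⟩ := (Set.finite_range fun c => ‖Y c‖).bddAbove
    exact MemLp.of_bound (integrable_comp_config (hη.measurable t) Y).1 B
      (.of_forall fun ω => hB ⟨η t ω, rfl⟩)
  have hfmem : MemLp (fun ω => ‖f ω‖) (ENNReal.ofReal 2) μ := by
    rw [ENNReal.ofReal_ofNat]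
    exact memLp_norm_sobolev hf
  have hYf : Integrable (fun ω => Y (η t ω) * ‖f ω‖) μ := by
    rw [ENNReal.ofReal_ofNat] at hYmem hfmem
    exact hYmem.integrable_mul hfmem
  calc |∫ ω, pairing (f ω).toL2 (ext (g (η t ω))) ∂μ|
      ≤ ∫ ω, |pairing (f ω).toL2 (ext (g (η t ω)))| ∂μ := abs_integral_le_integral_abs
    _ ≤ ∫ ω, Y (η t ω) * ‖f ω‖ ∂μ :=
        integral_mono (integrable_pairing hη hf t g).abs hYf fun ω => abs_pairing_ext_le _ _
    _ ≤ (∫ ω, Y (η t ω) ^ (2 : ℝ) ∂μ) ^ ((1 : ℝ) / 2) *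
          (∫ ω, ‖f ω‖ ^ (2 : ℝ) ∂μ) ^ ((1 : ℝ) / 2) :=
        integral_mul_le_Lp_mul_Lq_of_nonneg Real.HolderConjugate.two_two
          (.of_forall fun ω => Real.sqrt_nonneg _) (.of_forall fun ω => norm_nonneg _) hYmem hfmem
    _ = _ := by
        simp only [hY2, Real.rpow_two]
        rw [integral_finsetSum _ fun k _ => (integrable_comp_config (hη.measurable t)
          fun c => ‖discreteCoef (g c) k‖ ^ 2).const_mul (weight k ^ (-J))]
        simp only [integral_const_mul]

end SSEP

end

/-! ### Conclusion -/

theorem mainTheorem7 (d : ℕ) (J : ℝ) (hJ : (d : ℝ) / 2 < J) (T : ℝ) (hT : 0 < T) (K : ℝ) :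
    ∃ C : ℝ, ∀ ρ₀ : (n : ℕ) → SSEP.Site d n → ℝ,
      (∀ n, 1 ≤ n → ∀ x, ρ₀ n x ∈ Set.Icc (0 : ℝ) 1) →
      (∀ n, 1 ≤ n → SSEP.discreteGradNorm (ρ₀ n) ≤ K) →
      ∀ n : ℕ, 1 ≤ n →
      ∀ (Ω : Type*) [MeasurableSpace Ω] (μ : Measure Ω) [IsProbabilityMeasure μ]
        (η : ℝ≥0 → Ω → SSEP.Config d n),
      SSEP.IsSSEP μ η → SSEP.IsBernoulliStart μ η (ρ₀ n) →
      ∀ f : Ω → SSEP.Sobolev d J, MemLp f 2 μ →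
      ∀ (j : Fin d) (t : ℝ≥0), (t : ℝ) ≤ T →
        Integrable (fun ω => SSEP.pairing (f ω).toL2 (SSEP.ext
          (SSEP.fluctuation μ η t ω * SSEP.shift j (SSEP.fluctuation μ η t ω)))) μ ∧
        |((2 * (n : ℝ) + 1) ^ d)⁻¹ * ∫ ω, SSEP.pairing (f ω).toL2 (SSEP.ext
          (SSEP.fluctuation μ η t ω * SSEP.shift j (SSEP.fluctuation μ η t ω))) ∂μ| ≤
          C / (n : ℝ) ^ (min ((d : ℝ) / 2) 1) * (∫ ω, ‖f ω‖ ^ 2 ∂μ) ^ ((1 : ℝ) / 2) := by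
  rcases Nat.eq_zero_or_pos d with rfl | hd
  · exact ⟨0, fun _ _ _ _ _ _ _ _ _ _ _ _ _ _ j => j.elim0⟩
  -- The factor 2π undoes the scaling of `discreteGrad`; the maximum covers negative `K`.
  set D : ℝ := 2 * Real.pi * max K 0 with hD
  have hD0 : 0 ≤ D := by
    have := Real.pi_pos
    positivity
  obtain ⟨C₄, hC₄, hfour⟩ := SSEP.exists_abs_correlation_four_le hd hT.le hD0
  obtain ⟨S, hS, hsum⟩ := SSEP.exists_sum_weight_rpow_neg_le hd hJ
  refine ⟨(S * (3 + C₄)) ^ ((1 : ℝ) / 2), ?_⟩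
  intro ρ₀ hρ hK n hn Ω _ μ _ η hη hstart f hf j t htT
  have hn' : (1 : ℝ) ≤ n := by exact_mod_cast hn
  have hN : (0 : ℝ) < (2 * n + 1) ^ d := by positivity
  simp only [SSEP.fluctuation_mul_shift, SSEP.pairing_ext_smul]
  refine ⟨(SSEP.integrable_pairing hη hf t _).const_mul _, ?_⟩
  -- The scaling of the two fluctuation factors cancels the prefactor N^{-1}.
  rw [integral_const_mul, inv_mul_cancel_left₀ hN.ne']
  refine (SSEP.abs_integral_pairing_le hη hf t _).trans ?_
  gcongr
  set b : ℝ := min ((d : ℝ) / 2) 1 with hb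
  set q : ℝ := (n : ℝ) ^ (-(2 * b)) with hq
  have hq0 : 0 ≤ q := by positivity
  have hcorr : ∀ A : Finset (SSEP.Site d n), A.card = 4 →
      |SSEP.correlation (SSEP.lawEvolution μ η) t A| ≤ C₄ * q := by
    intro A hA
    refine hfour n hn _ hη.isForwardEvolution (fun i x => ?_)
      (fun B hB => hη.correlation_zero hstart.indep hB) t t.2 htT A hA
    have hmean := fun x => (hη.mean_lawEvolution 0 x).trans
      (SSEP.meanField_zero hη (fun x => (hρ n hn x).1) hstart x)
    rw [NNReal.coe_zero] at hmean
    rw [hmean, hmean]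
    exact SSEP.abs_add_unitVec_sub_le _ ((hK n hn).trans (le_max_left _ _)) i x
  -- The overlapping pairs contribute 3/N, which is at most 3 n^{-d}; this is of the required order
  -- because 2b ≤ d.
  have hNq : ((2 * (n : ℝ) + 1) ^ d)⁻¹ ≤ q := by
    refine (SSEP.inv_pow_le_rpow hn).trans (Real.rpow_le_rpow_of_exponent_le hn' ?_)
    have := min_le_left ((d : ℝ) / 2) 1
    linarith
  have hcoef : ∀ k, ∫ ω, ‖SSEP.discreteCoef (SSEP.neighbourProduct μ η t j (η t ω)) k‖ ^ 2 ∂μ ≤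
      (3 + C₄) * q := by
    intro k
    simp only [SSEP.norm_sq_discreteCoef]
    rw [integral_const_mul]
    have h := SSEP.integral_norm_sq_sum_le hη hn t j (by positivity) hcorr
      (fun x => conj (SSEP.character k x.point))
      fun x => by rw [RCLike.norm_conj, SSEP.norm_character]
    refine (mul_le_mul_of_nonneg_left h (by positivity)).trans ?_
    calc (((2 * (n : ℝ) + 1) ^ d)⁻¹) ^ 2 *
          (3 * (2 * n + 1) ^ d + ((2 * n + 1) ^ d) ^ 2 * (C₄ * q))
        = 3 * ((2 * (n : ℝ) + 1) ^ d)⁻¹ + C₄ * q := by field_simp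
      _ ≤ (3 + C₄) * q := by linarith
  have htotal : ∑ k ∈ SSEP.freqBox d n, SSEP.weight k ^ (-J) *
      ∫ ω, ‖SSEP.discreteCoef (SSEP.neighbourProduct μ η t j (η t ω)) k‖ ^ 2 ∂μ ≤
      S * (3 + C₄) * q := by
    calc _ ≤ ∑ k ∈ SSEP.freqBox d n, SSEP.weight k ^ (-J) * ((3 + C₄) * q) :=
          Finset.sum_le_sum fun k _ => mul_le_mul_of_nonneg_left (hcoef k)
            (Real.rpow_nonneg (SSEP.weight_pos k).le _)
      _ ≤ S * ((3 + C₄) * q) := by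
          rw [← Finset.sum_mul]
          exact mul_le_mul_of_nonneg_right (hsum n) (by positivity)
      _ = _ := by ring
  have hqb : q ^ ((1 : ℝ) / 2) = ((n : ℝ) ^ b)⁻¹ := by
    rw [hq, ← Real.rpow_mul (by positivity), ← Real.rpow_neg (by positivity)]
    congr 1
    ring
  calc _ ≤ (S * (3 + C₄) * q) ^ ((1 : ℝ) / 2) := by
        refine Real.rpow_le_rpow (Finset.sum_nonneg fun k _ => mul_nonneg
          (Real.rpow_nonneg (SSEP.weight_pos k).le _) (integral_nonneg fun ω => sq_nonneg _))
          htotal (by norm_num)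
    _ = _ := by rw [Real.mul_rpow (by positivity) hq0, hqb, ← div_eq_mul_inv]
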